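/- Let $m\in\mathbb{N}$ and let $\alpha=\{\alpha_k\}_{k\in\mathbb{Z}}$ be a sequence of complex $m\times m$ matrices with operator norm $\|\alpha_k\|<1$ for all $k\in\mathbb{Z}$. Put $$\rho_k=(I_m-\alpha_k^*\alpha_k)^{1/2},\qquad \widetilde\rho_k=(I_m-\alpha_k\alpha_k^*)^{1/2},\qquad \Theta_k=\begin{pmatrix}-\alpha_k&\widetilde\rho_k\\ \rho_k&\alpha_k^*\end{pmatrix}.$$ Let $\mathbb{V}$ be the block diagonal operator on $\ell^2(\mathbb{Z})\otimes\mathbb{C}^m$ that acts as $\Theta_{2k}$ on the pair of sites $(2k-1,2k)$, let $\mathbb{W}$ be the one that acts as $\Theta_{2k+1}$ on the pair of sites $(2k,2k+1)$, $k\in\mathbb{Z}$, and let $\mathbb{U}=\mathbb{V}\mathbb{W}$ be the CMV operator. For $k_0\in\mathbb{Z}$ and $|z|<1$ let $$M_{1,1}(z,k_0)=\Delta_{k_0}(\mathbb{U}+zI)(\mathbb{U}-zI)^{-1}\Delta_{k_0}\in\mathbb{C}^{m\times m},$$ where $\Delta_{k_0}$ is the orthogonal projection onto the $m$-dimensional subspace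 of sequences supported at $k_0$. Let $\ln$ denote the principal logarithm of matrices, $\ln A=\int_0^1(A-I_m)(I_m+t(A-I_m))^{-1}dt$, let $\operatorname{Im}(A)=(A-A^*)/(2i)$, and let $d\mu_0(e^{i\theta})=d\theta/(2\pi)$ be the normalized Lebesgue measure on the unit circle $\partial\mathbb{D}$. Then for every $k_0\in\mathbb{Z}$ the following hold. The function $z\mapsto\ln M_{1,1}(z,k_0)$ is analytic at $z=0$, and with its Taylor coefficients $L_j(\mathbb{U},k_0)$ at $0$ one has the norm convergent expansion $$\ln M_{1,1}(z,k_0)=\sum_{j=1}^\infty L_j(\mathbb{U},k_0)z^j\quad\text{for $|z|$ sufficiently small.}$$ The radial limit $$\Xi_{1,1}(\zeta,k_0)=\lim_{r\uparrow1}\operatorname{Im}\big(\ln M_{1,1}(r\zeta,k_0)\big)$$ exists for $\mu_0$-a.e. $\zeta\in\partial\mathbb{D}$ and defines a $\mu_0$-integrable function. The trace formulas $$L_j(\mathbb{U},k_0)=2i\oint_{\partial\mathbb{D}}\Xi_{1,1}(\zeta,k_0)\,\overline{\zeta}^{\,j}\,d\mu_0(\zeta),\qquad j\ge1,$$ hold.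 In particular, $$L_1(\mathbb{U},k_0)=-2\begin{cases}\alpha_{k_0}\alpha_{k_0+1}^*,&k_0\text{ odd},\\ \alpha_{k_0+1}^*\alpha_{k_0},&k_0\text{ even},\end{cases}\;=\;2i\oint_{\partial\mathbb{D}}\Xi_{1,1}(\zeta,k_0)\,\overline{\zeta}\,d\mu_0(\zeta),$$ $$L_2(\mathbb{U},k_0)=-2\begin{cases}\alpha_{k_0}\rho_{k_0+1}\alpha_{k_0+2}^*\widetilde\rho_{k_0+1}+\widetilde\rho_{k_0}\alpha_{k_0-1}\rho_{k_0}\alpha_{k_0+1}^*,&k_0\text{ odd},\\ \rho_{k_0+1}\alpha_{k_0+2}^*\widetilde\rho_{k_0+1}\alpha_{k_0}+\alpha_{k_0+1}^*\widetilde\rho_{k_0}\alpha_{k_0-1}\rho_{k_0},&k_0\text{ even},\end{cases}\;=\;2i\oint_{\partial\mathbb{D}}\Xi_{1,1}(\zeta,k_0)\,\overline{\zeta}^{\,2}\,d\mu_0(\zeta).$$ -/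

import Mathlib

open Filter Topology MeasureTheory
open scoped Matrix Matrix.Norms.L2Operator MatrixOrder ComplexConjugate

noncomputable section

namespace CMV

/-- Complex `m × m` matrices; the norm in force is the operator norm of the Euclidean space `ℂᵐ`. -/
abbrev Mat (m : ℕ) : Type := Matrix (Fin m) (Fin m) ℂ

/-- The Hilbert space `ℓ²(ℤ) ⊗ ℂᵐ` of square summable sequences of vectors. -/
abbrev Ell2 (m : ℕ) : Type := lp (fun _ : ℤ => EuclideanSpace ℂ (Fin m)) 2

variable {m : ℕ}

/-- `ρₖ = (I - αₖ* αₖ)^{1/2}`. -/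
def rho (α : ℤ → Mat m) (k : ℤ) : Mat m := CFC.sqrt (1 - (α k)ᴴ * α k)

/-- `ρ̃ₖ = (I - αₖ αₖ*)^{1/2}`. -/
def rhoT (α : ℤ → Mat m) (k : ℤ) : Mat m := CFC.sqrt (1 - α k * (α k)ᴴ)

theorem norm_sqrt_le_one (a : Mat m) : ‖CFC.sqrt (1 - aᴴ * a)‖ ≤ 1 := by
  by_cases h : 0 ≤ 1 - aᴴ * a
  · rw [CFC.norm_sqrt _ h, Real.sqrt_le_one]
    refine (CStarAlgebra.norm_le_one_iff_of_nonneg _ h).2 ?_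
    exact sub_le_self _ (star_mul_self_nonneg a)
  · have : CFC.sqrt (1 - aᴴ * a) = 0 := cfcₙ_apply_of_not_predicate _ h
    rw [this, norm_zero]
    exact zero_le_one

theorem norm_rho_le (α : ℤ → Mat m) (k : ℤ) : ‖rho α k‖ ≤ 1 := norm_sqrt_le_one _

theorem norm_rhoT_le (α : ℤ → Mat m) (k : ℤ) : ‖rhoT α k‖ ≤ 1 := by
  have := norm_sqrt_le_one (α k)ᴴ
  rwa [Matrix.conjTranspose_conjTranspose] at this

/-- The `ℂᵐ`-valued sequence obtained by applying to `φ`, for every `j` with `P j`, the block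
`Θⱼ = [[-αⱼ, ρ̃ⱼ], [ρⱼ, αⱼ*]]` at the two sites `j - 1, j`. Here `P` is one of the two parities, so
that every site `n` is either the second site of `Θₙ` (if `P n`) or the first site of `Θₙ₊₁`. -/
def blockFun (α : ℤ → Mat m) (P : ℤ → Prop) [DecidablePred P]
    (φ : ℤ → EuclideanSpace ℂ (Fin m)) (n : ℤ) : EuclideanSpace ℂ (Fin m) :=
  if P n then
    Matrix.toEuclideanCLM (𝕜 := ℂ) (rho α n) (φ (n - 1)) +
      Matrix.toEuclideanCLM (𝕜 := ℂ) (α n)ᴴ (φ n)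
  else
    Matrix.toEuclideanCLM (𝕜 := ℂ) (-α (n + 1)) (φ n) +
      Matrix.toEuclideanCLM (𝕜 := ℂ) (rhoT α (n + 1)) (φ (n + 1))

theorem norm_toEuclideanCLM_le {A : Mat m} (hA : ‖A‖ ≤ 1) (x : EuclideanSpace ℂ (Fin m)) :
    ‖Matrix.toEuclideanCLM (𝕜 := ℂ) A x‖ ≤ ‖x‖ := by
  refine (ContinuousLinearMap.le_opNorm _ _).trans ?_
  rw [Matrix.l2_opNorm_toEuclideanCLM]
  exact mul_le_of_le_one_left (norm_nonneg x) hA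

theorem sum_blockFun_le (α : ℤ → Mat m) (hα : ∀ k, ‖α k‖ < 1) (P : ℤ → Prop) [DecidablePred P]
    (φ : Ell2 m) (s : Finset ℤ) :
    ∑ n ∈ s, ‖blockFun α P φ n‖ ^ (2 : ENNReal).toReal ≤ (3 * ‖φ‖) ^ (2 : ENNReal).toReal := by
  simp only [ENNReal.toReal_ofNat, Real.rpow_two]
  have hpt : ∀ n, ‖blockFun α P φ n‖ ^ 2 ≤
      3 * (‖φ (n + (-1))‖ ^ 2 + ‖φ (n + 0)‖ ^ 2 + ‖φ (n + 1)‖ ^ 2) := by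
    intro n
    have h : ‖blockFun α P φ n‖ ≤ ‖φ (n + (-1))‖ + ‖φ (n + 0)‖ + ‖φ (n + 1)‖ := by
      rw [add_zero, ← sub_eq_add_neg]
      have h0 := norm_nonneg (φ (n - 1))
      have h1 := norm_nonneg (φ (n + 1))
      unfold blockFun
      split_ifs
      · have e1 := norm_toEuclideanCLM_le (norm_rho_le α n) (φ (n - 1))
        have e2 := norm_toEuclideanCLM_le (A := (α n)ᴴ)
          ((Matrix.l2_opNorm_conjTranspose _).trans_le (hα n).le) (φ n)
        exact (norm_add_le _ _).trans (by linarith)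
      · have e1 := norm_toEuclideanCLM_le (A := -α (n + 1))
          ((norm_neg _).trans_le (hα (n + 1)).le) (φ n)
        have e2 := norm_toEuclideanCLM_le (norm_rhoT_le α (n + 1)) (φ (n + 1))
        exact (norm_add_le _ _).trans (by linarith)
    have := pow_le_pow_left₀ (norm_nonneg _) h 2
    nlinarith [sq_nonneg (‖φ (n + (-1))‖ - ‖φ (n + 0)‖), sq_nonneg (‖φ (n + 0)‖ - ‖φ (n + 1)‖),
      sq_nonneg (‖φ (n + (-1))‖ - ‖φ (n + 1)‖)]
  have hshift : ∀ c : ℤ, ∑ n ∈ s, ‖φ (n + c)‖ ^ 2 ≤ ‖φ‖ ^ 2 := by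
    intro c
    have := lp.sum_rpow_le_norm_rpow (by norm_num) φ (s.map (addRightEmbedding c))
    simpa using this
  calc ∑ n ∈ s, ‖blockFun α P φ n‖ ^ 2
      ≤ ∑ n ∈ s, 3 * (‖φ (n + (-1))‖ ^ 2 + ‖φ (n + 0)‖ ^ 2 + ‖φ (n + 1)‖ ^ 2) :=
        Finset.sum_le_sum fun n _ => hpt n
    _ ≤ (3 * ‖φ‖) ^ 2 := by
        rw [← Finset.mul_sum, Finset.sum_add_distrib, Finset.sum_add_distrib]
        nlinarith [hshift (-1), hshift 0, hshift 1]

/-- The block diagonal operator on `ℓ²(ℤ) ⊗ ℂᵐ` built from the blocks `Θⱼ`, `P j`. -/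
def blockOp (α : ℤ → Mat m) (hα : ∀ k, ‖α k‖ < 1) (P : ℤ → Prop) [DecidablePred P] :
    Ell2 m →L[ℂ] Ell2 m :=
  LinearMap.mkContinuous
    { toFun := fun φ => ⟨blockFun α P φ, memℓp_gen' (sum_blockFun_le α hα P φ)⟩
      map_add' := fun φ ψ => by
        ext1
        funext n
        simp only [blockFun, lp.coeFn_add, Pi.add_apply, map_add]
        split_ifs <;> abel
      map_smul' := fun c φ => by
        ext1
        funext n
        simp only [blockFun, lp.coeFn_smul, Pi.smul_apply, map_smul, RingHom.id_apply]
        split_ifs <;> rw [smul_add] }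
    3 fun φ => lp.norm_le_of_forall_sum_le (by norm_num) (by positivity) (sum_blockFun_le α hα P φ)

/-- `𝕍`: the block `Θ₂ₖ` at the sites `2k - 1, 2k`. -/
def opV (α : ℤ → Mat m) (hα : ∀ k, ‖α k‖ < 1) : Ell2 m →L[ℂ] Ell2 m := blockOp α hα Even

/-- `𝕎`: the block `Θ₂ₖ₊₁` at the sites `2k, 2k + 1`. -/
def opW (α : ℤ → Mat m) (hα : ∀ k, ‖α k‖ < 1) : Ell2 m →L[ℂ] Ell2 m := blockOp α hα Odd

/-- The CMV operator `𝕌 = 𝕍 𝕎`. -/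
def opU (α : ℤ → Mat m) (hα : ∀ k, ‖α k‖ < 1) : Ell2 m →L[ℂ] Ell2 m := opV α hα * opW α hα

/-- `M₁,₁(z, k₀)`: the `m × m` matrix of the compression of `(𝕌 + z)(𝕌 - z)⁻¹` to the site `k₀`. -/
def M11 (α : ℤ → Mat m) (hα : ∀ k, ‖α k‖ < 1) (k₀ : ℤ) (z : ℂ) : Mat m :=
  Matrix.of fun i j =>
    ((opU α hα + z • 1) * Ring.inverse (opU α hα - z • 1))
      (lp.single 2 k₀ (EuclideanSpace.single j (1 : ℂ))) k₀ i

/-- The principal logarithm of a matrix `A` without spectrum on `(-∞, 0]`, as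
`ln A = ∫₀¹ (A - I)(I + t (A - I))⁻¹ dt`. -/
def matLog (A : Mat m) : Mat m := ∫ t in (0 : ℝ)..1, (A - 1) * (1 + (t : ℂ) • (A - 1))⁻¹

theorem commute_inv {X Y : Mat m} (h : Commute X Y) : Commute X Y⁻¹ := by
  by_cases hY : IsUnit Y.det
  · let _ := Matrix.invertibleOfIsUnitDet Y hY
    rw [← Matrix.invOf_eq_nonsing_inv]
    exact h.invOf_right
  · rw [Matrix.nonsing_inv_apply_not_isUnit _ hY]; exact Commute.zero_right _

theorem commute_integral {X : Mat m} {f : ℝ → Mat m} {a b : ℝ} (hf : IntervalIntegrable f volume a b)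
    (h : ∀ t, Commute X (f t)) : Commute X (∫ t in a..b, f t) := by
  have h1 := ((ContinuousLinearMap.mul ℝ (Mat m)) X).intervalIntegral_comp_comm hf
  have h2 := ((ContinuousLinearMap.mul ℝ (Mat m)).flip X).intervalIntegral_comp_comm hf
  simp only [ContinuousLinearMap.mul_apply', ContinuousLinearMap.flip_apply] at h1 h2
  rw [Commute, SemiconjBy, ← h1, ← h2]
  exact intervalIntegral.integral_congr fun t _ => h t

/-- `exp (ln A) = A` as soon as the segment from `I` to `A` consists of invertible matrices. -/
theorem exp_matLog (A : Mat m)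
    (hA : ∀ t ∈ Set.Icc (0 : ℝ) 1, IsUnit (1 + (t : ℂ) • (A - 1))) :
    NormedSpace.exp (matLog A) = A := by
  set B := A - 1 with hB
  set X : ℝ → Mat m := fun t => 1 + (t : ℂ) • B with hX
  set f : ℝ → Mat m := fun t => B * (X t)⁻¹ with hf
  have hXc : Continuous X := by fun_prop
  have hO : IsOpen {t : ℝ | IsUnit (X t)} := Units.isOpen.preimage hXc
  have hfc : ContinuousOn f {t : ℝ | IsUnit (X t)} := by
    intro t ht
    obtain ⟨u, hu⟩ := ht
    have : ContinuousAt f t := by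
      refine continuousAt_const.mul ?_
      have h := NormedRing.inverse_continuousAt u
      rw [hu] at h
      simp only [Matrix.nonsing_inv_eq_ringInverse]
      exact h.comp hXc.continuousAt
    exact this.continuousWithinAt
  have hint : ∀ a ∈ Set.Icc (0 : ℝ) 1, ∀ b ∈ Set.Icc (0 : ℝ) 1, IntervalIntegrable f volume a b := by
    intro a ha b hb
    refine (hfc.mono ?_).intervalIntegrable
    intro t ht
    exact hA t (Set.uIcc_subset_Icc ha hb ht)
  have hcomX : ∀ s t, Commute (X s) (X t) := by
    intro s t
    simp only [hX]
    exact ((Commute.one_left _).add_left (((Commute.one_right _).add_right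
      ((Commute.refl B).smul_right _)).smul_left _))
  have hcomBX : ∀ t, Commute B (X t) := fun t =>
    (Commute.one_right _).add_right ((Commute.refl B).smul_right _)
  have hff : ∀ s t, Commute (f s) (f t) := by
    intro s t
    have h1 : Commute B (f t) := (Commute.refl B).mul_right (commute_inv (hcomBX t))
    have h2 : Commute (X s) (f t) := (hcomBX s).symm.mul_right (commute_inv (hcomX s t))
    exact h1.mul_left (commute_inv h2.symm).symm
  have h01 : (0 : ℝ) ∈ Set.Icc (0 : ℝ) 1 := by simp
  set F : ℝ → Mat m := fun s => ∫ t in (0 : ℝ)..s, f t with hF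
  have hFd : ∀ s ∈ Set.Icc (0 : ℝ) 1, HasDerivAt F (f s) s := by
    intro s hs
    exact intervalIntegral.integral_hasDerivAt_right (hint 0 h01 s hs)
      (hfc.stronglyMeasurableAtFilter hO s (hA s hs)) (hfc.continuousAt (hO.mem_nhds (hA s hs)))
  have hE : ∀ s ∈ Set.Icc (0 : ℝ) 1,
      HasDerivWithinAt (fun t => NormedSpace.exp (-F t)) (NormedSpace.exp (-F s) * (-f s))
        (Set.Icc 0 1) s := by
    intro s hs
    have hg : HasDerivWithinAt (fun t => F s - F t) (-f s) (Set.Icc 0 1) s := by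
      simpa using ((hFd s hs).const_sub (F s)).hasDerivWithinAt
    have he : HasFDerivAt (NormedSpace.exp : Mat m → Mat m) (1 : Mat m →L[ℝ] Mat m) (F s - F s) := by
      rw [sub_self]; exact (hasStrictFDerivAt_exp_zero (𝕂 := ℝ)).hasFDerivAt
    have h := (he.comp_hasDerivWithinAt s hg).const_mul (NormedSpace.exp (-F s))
    simp only [one_apply_eq_self] at h
    refine h.congr_of_eventuallyEq_of_mem ?_ hs
    filter_upwards [self_mem_nhdsWithin] with t ht
    have hc : Commute (F s) (F t) :=
      commute_integral (hint 0 h01 t ht) fun u =>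
        (commute_integral (hint 0 h01 s hs) fun v => hff u v).symm
    simp only [Function.comp]
    rw [← Matrix.exp_add_of_commute _ _ ((Commute.refl _).sub_right hc).neg_left]
    congr 1
    abel
  have hconst : ∀ s ∈ Set.Icc (0 : ℝ) 1,
      HasDerivWithinAt (fun t => NormedSpace.exp (-F t) * X t) 0 (Set.Icc 0 1) s := by
    intro s hs
    have hXd : HasDerivWithinAt X B (Set.Icc 0 1) s := by
      have : HasDerivAt (fun t : ℝ => (t : ℂ) • B) ((1 : ℂ) • B) s :=
        (Complex.ofRealCLM.hasDerivAt (x := s)).smul_const B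
      simpa [hX] using (this.const_add 1).hasDerivWithinAt
    have h := (hE s hs).mul hXd
    have h2 : f s * X s = B := by
      simp only [hf]
      rw [mul_assoc, Matrix.nonsing_inv_mul _ ((Matrix.isUnit_iff_isUnit_det _).1 (hA s hs)),
        mul_one]
    have h3 : NormedSpace.exp (-F s) * (-f s) * X s + NormedSpace.exp (-F s) * B = 0 := by
      rw [mul_assoc, neg_mul, h2, mul_neg, neg_add_cancel]
    exact h3 ▸ h
  have hc := (convex_Icc (0 : ℝ) 1).norm_image_sub_le_of_norm_hasDerivWithin_le (C := 0)
    (fun s hs => hconst s hs) (fun _ _ => norm_zero.le) h01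
    (show (1 : ℝ) ∈ Set.Icc (0 : ℝ) 1 by simp)
  rw [zero_mul, norm_le_zero_iff, sub_eq_zero] at hc
  replace hc := hc.symm
  have hX1 : X 1 = A := by simp [hX, hB]
  have hX0 : X 0 = 1 := by simp [hX]
  have hF0 : F 0 = 0 := by simp [hF]
  have hF1 : F 1 = matLog A := rfl
  rw [hX1, hX0, hF0, hF1, neg_zero, NormedSpace.exp_zero, one_mul] at hc
  have : NormedSpace.exp (matLog A) * NormedSpace.exp (-matLog A) = 1 := by
    rw [← Matrix.exp_add_of_commute _ _ ((Commute.refl (matLog A)).neg_right), add_neg_cancel,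
      NormedSpace.exp_zero]
  calc NormedSpace.exp (matLog A)
      = NormedSpace.exp (matLog A) * (NormedSpace.exp (-matLog A) * A) := by
        rw [← hc, mul_one]
    _ = A := by rw [← mul_assoc, this, one_mul]

/-- `Im A = (A - A*) / (2i)`. -/
def imPart (A : Mat m) : Mat m := (2 * Complex.I)⁻¹ • (A - Aᴴ)

/-- `Ξ₁,₁(ζ, k₀) = lim_{r ↑ 1} Im ln M₁,₁(rζ, k₀)`. -/
def Xi11 (α : ℤ → Mat m) (hα : ∀ k, ‖α k‖ < 1) (k₀ : ℤ) (ζ : ℂ) : Mat m :=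
  limUnder (𝓝[<] (1 : ℝ)) fun r : ℝ => imPart (matLog (M11 α hα k₀ (r * ζ)))

/-- `Lⱼ(𝕌, k₀)`: the `j`-th Taylor coefficient of `ln M₁,₁(·, k₀)` at `0`. -/
def L (α : ℤ → Mat m) (hα : ∀ k, ‖α k‖ < 1) (k₀ : ℤ) (j : ℕ) : Mat m :=
  ((j.factorial : ℂ)⁻¹) • iteratedDeriv j (fun z : ℂ => matLog (M11 α hα k₀ z)) 0

end CMV

end

/-! The CMV operator `U` is unitary, so `(U + z)(U - z)⁻¹`, and with it the compression `M11`, has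
positive definite real part throughout the unit disk. Hence the segment from `1` to `M11` consists
of invertible matrices, the logarithm is analytic in the whole disk, and it vanishes at `0` because
`M11` equals `1` there.

The trace formulas are statements about Fourier coefficients on the boundary. Accretivity bounds the
imaginary part of the logarithm by a constant: along the segment from an accretive matrix to `±i`
the quadratic form of `± Im ln` increases, so it is at most its value at `±i`
(`im_inner_matLog_le`). If `f` and `g` are entries of `ln M11` at transposed positions, then `f -
conj g` is bounded. Since `f g` has mean `f(0) g(0) = 0` on every circle about `0`, expanding `|f -
conj g|²` bounds the means of `|f|²`, so `f` lies in the Hardy space `H²`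
(`summable_sq_of_norm_sub_conj_le`).

A function in `H²` that vanishes at `0` has radial limits a.e., given by an `L²` function with the
same coefficients (`exists_radial_limit`). The integrated Fourier series converges absolutely to a
primitive of that function, Lebesgue's theorem differentiates the primitive a.e., and Fatou's
theorem (`tendsto_tsum_of_hasDerivAt`) turns the derivative into an Abel limit. The boundary
function `G` of `ln M11` thus has Fourier coefficients `L n` for `n ≥ 0` and `0` for `n < 0`. In `Ξ
= (G - G*) / (2i)` the adjoint contributes no positive frequency, so the coefficient of index `n ≥
1` is `L n / (2i)`.

For the explicit coefficients put `V = U⁻¹` and write `A₁`, `A₂` for the compressions of `V`, `V²`.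
Then `M11 = 1 + 2zA₁ + 2z²A₂ + O(z³)`, and comparison with the exponential of the Taylor series
gives `L 1 = 2A₁` and `L 2 = 2(A₂ - A₁²)`. The entries of `V` are explicit, since its blocks are
those of `U` with `α` replaced by its adjoint (`L_one_L_two`). -/

noncomputable section

namespace CMV

/-! ### Poisson kernel and Fatou's theorem on Abel summability -/

/-- The Poisson kernel of the unit disk. -/
def pKer (r s : ℝ) : ℝ := (1 - r ^ 2) / (1 - 2 * r * Real.cos s + r ^ 2)

/-- Minus the angular derivative of the Poisson kernel. -/
def qKer (r s : ℝ) : ℝ :=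
  (1 - r ^ 2) * (2 * r * Real.sin s) / (1 - 2 * r * Real.cos s + r ^ 2) ^ 2

theorem ker_den_pos {r : ℝ} (h0 : 0 ≤ r) (h1 : r < 1) (s : ℝ) :
    0 < 1 - 2 * r * Real.cos s + r ^ 2 := by
  nlinarith [Real.cos_le_one s, mul_nonneg h0 (sub_nonneg.2 (Real.cos_le_one s)),
    mul_pos (sub_pos.2 h1) (sub_pos.2 h1)]

theorem continuous_qKer {r : ℝ} (h0 : 0 ≤ r) (h1 : r < 1) : Continuous (qKer r) := by
  unfold qKer
  exact Continuous.div (by fun_prop) (by fun_prop) fun s => (pow_pos (ker_den_pos h0 h1 s) 2).ne'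

theorem continuous_pKer {r : ℝ} (h0 : 0 ≤ r) (h1 : r < 1) : Continuous (pKer r) := by
  unfold pKer
  exact Continuous.div (by fun_prop) (by fun_prop) fun s => (ker_den_pos h0 h1 s).ne'

theorem hasDerivAt_pKer {r : ℝ} (h0 : 0 ≤ r) (h1 : r < 1) (s : ℝ) :
    HasDerivAt (pKer r) (-qKer r s) s := by
  have hd : HasDerivAt (fun s => 1 - 2 * r * Real.cos s + r ^ 2) (2 * r * Real.sin s) s := by
    have := (((Real.hasDerivAt_cos s).const_mul (2 * r)).const_sub 1).add_const (r ^ 2)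
    simpa using this
  have h := (hasDerivAt_const s (1 - r ^ 2)).div hd (ker_den_pos h0 h1 s).ne'
  refine h.congr_deriv ?_
  simp [qKer, neg_div]

/-- This is Poisson's formula for the function `z ^ n` at the point `r`, moved to a symmetric
period. -/
theorem integral_pKer_mul_cexp {r : ℝ} (h0 : 0 ≤ r) (h1 : r < 1) (n : ℕ) :
    ∫ s in -Real.pi..Real.pi, (pKer r s : ℂ) * Complex.exp (n * s * Complex.I) =
      2 * Real.pi * (r : ℂ) ^ n := by
  have hf : DiffContOnCl ℂ (fun z : ℂ => z ^ n) (Metric.ball 0 1) :=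
    (Differentiable.diffContOnCl (by fun_prop))
  have hw : (r : ℂ) ∈ Metric.ball (0 : ℂ) 1 := by
    simp [abs_of_nonneg h0, h1]
  have h := hf.circleAverage_poissonKernel_smul hw
  rw [Real.circleAverage_def] at h
  have hper : Function.Periodic
      (fun s : ℝ => (pKer r s : ℂ) * Complex.exp (n * s * Complex.I)) (2 * Real.pi) := by
    intro s
    simp only [pKer, Real.cos_add_two_pi]
    congr 1
    have : (n : ℂ) * ((s + 2 * Real.pi : ℝ) : ℂ) * Complex.I =
        n * s * Complex.I + n * (2 * Real.pi * Complex.I) := by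
      push_cast; ring
    rw [this, Complex.exp_add, Complex.exp_nat_mul_two_pi_mul_I, mul_one]
  have h2 := hper.intervalIntegral_add_eq (-Real.pi) 0
  have e1 : -Real.pi + 2 * Real.pi = Real.pi := by ring
  rw [e1, zero_add] at h2
  rw [h2]
  have h3 : ∀ s : ℝ, (poissonKernel 0 (r : ℂ) • fun z : ℂ => z ^ n) (circleMap 0 1 s) =
      (pKer r s : ℂ) * Complex.exp (n * s * Complex.I) := by
    intro s
    have hk : poissonKernel 0 (r : ℂ) (circleMap 0 1 s) = pKer r s := by
      rw [poissonKernel_def, pKer]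
      have e : ‖circleMap 0 1 s - (r : ℂ)‖ ^ 2 = 1 - 2 * r * Real.cos s + r ^ 2 := by
        rw [← Complex.normSq_eq_norm_sq, Complex.normSq_apply]
        simp [circleMap, Complex.exp_ofReal_mul_I_re, Complex.exp_ofReal_mul_I_im]
        nlinarith [Real.sin_sq_add_cos_sq s]
      simp only [sub_zero]
      rw [e]
      simp
    rw [Pi.smul_apply', hk, Complex.real_smul]
    simp [circleMap, ← Complex.exp_nat_mul, mul_assoc]
  simp only [h3] at h
  rw [inv_smul_eq_iff₀ (by positivity)] at h
  rw [h, Complex.real_smul]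
  push_cast
  ring

/-- Integration by parts moves the derivative from the Poisson kernel to the exponential; the
boundary terms cancel by periodicity. -/
theorem integral_qKer_mul_cexp {r : ℝ} (h0 : 0 ≤ r) (h1 : r < 1) (n : ℕ) :
    ∫ s in -Real.pi..Real.pi, (qKer r s : ℂ) * Complex.exp (n * s * Complex.I) =
      2 * Real.pi * (n * Complex.I * (r : ℂ) ^ n) := by
  have hP := continuous_pKer h0 h1
  have hQ := continuous_qKer h0 h1
  have hd : ∀ s : ℝ, HasDerivAt (fun s : ℝ => (pKer r s : ℂ) * Complex.exp (n * s * Complex.I))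
      (((-qKer r s : ℝ) : ℂ) * Complex.exp (n * s * Complex.I) +
        (pKer r s : ℂ) * (Complex.exp (n * s * Complex.I) * (n * Complex.I))) s := by
    intro s
    have h2 : HasDerivAt (fun s : ℝ => (n : ℂ) * s * Complex.I) (n * Complex.I) s := by
      simpa using (((Complex.ofRealCLM.hasDerivAt (x := s)).const_mul (n : ℂ)).mul_const Complex.I)
    exact ((hasDerivAt_pKer h0 h1 s).ofReal_comp).mul h2.cexp
  have h := intervalIntegral.integral_eq_sub_of_hasDerivAt (a := -Real.pi) (b := Real.pi)
    (fun s _ => hd s) (by apply Continuous.intervalIntegrable; fun_prop)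
  rw [intervalIntegral.integral_add (by apply Continuous.intervalIntegrable; fun_prop)
    (by apply Continuous.intervalIntegrable; fun_prop)] at h
  have hb : (pKer r Real.pi : ℂ) * Complex.exp (n * (Real.pi : ℝ) * Complex.I) -
      (pKer r (-Real.pi) : ℂ) * Complex.exp (n * ((-Real.pi : ℝ) : ℂ) * Complex.I) = 0 := by
    have e : (n : ℂ) * (Real.pi : ℝ) * Complex.I =
        n * ((-Real.pi : ℝ) : ℂ) * Complex.I + n * (2 * Real.pi * Complex.I) := by
      push_cast; ring
    rw [e, Complex.exp_add, Complex.exp_nat_mul_two_pi_mul_I]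
    simp [pKer]
  rw [hb] at h
  have e1 : ∀ s : ℝ, ((-qKer r s : ℝ) : ℂ) * Complex.exp (n * s * Complex.I) =
      -((qKer r s : ℂ) * Complex.exp (n * s * Complex.I)) := by intro s; push_cast; ring
  have e2 : ∀ s : ℝ, (pKer r s : ℂ) * (Complex.exp (n * s * Complex.I) * (n * Complex.I)) =
      n * Complex.I * ((pKer r s : ℂ) * Complex.exp (n * s * Complex.I)) := by intro s; ring
  simp only [e1, e2] at h
  rw [intervalIntegral.integral_neg, intervalIntegral.integral_const_mul,
    integral_pKer_mul_cexp h0 h1] at h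
  linear_combination -h

/-- Integrate the derivative of `s * pKer r s`. The value is at most `2π` and tends to `2π`, so
together with `id_mul_qKer_nonneg` and `abs_qKer_le` it makes `s * qKer r s / (2π)` an approximate
identity on `[-π, π]`. -/
theorem integral_id_mul_qKer {r : ℝ} (h0 : 0 ≤ r) (h1 : r < 1) :
    ∫ s in -Real.pi..Real.pi, s * qKer r s = 2 * Real.pi - 2 * Real.pi * ((1 - r) / (1 + r)) := by
  have hP := continuous_pKer h0 h1
  have hQ := continuous_qKer h0 h1
  have h := intervalIntegral.integral_eq_sub_of_hasDerivAt (a := -Real.pi) (b := Real.pi)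
    (fun s _ => (hasDerivAt_id s).mul (hasDerivAt_pKer h0 h1 s))
    (by apply Continuous.intervalIntegrable; simp only [id]; fun_prop)
  have e : ∀ s, 1 * pKer r s + id s * -qKer r s = pKer r s - s * qKer r s := by
    intro s; simp only [id]; ring
  simp only [e] at h
  rw [intervalIntegral.integral_sub (hP.intervalIntegrable _ _)
    (by apply Continuous.intervalIntegrable; fun_prop)] at h
  have hp : ∫ s in -Real.pi..Real.pi, pKer r s = 2 * Real.pi := by
    have := integral_pKer_mul_cexp h0 h1 0
    simp only [Nat.cast_zero, zero_mul, Complex.exp_zero, mul_one, pow_zero] at this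
    rw [intervalIntegral.integral_ofReal] at this
    exact_mod_cast this
  have hpi : pKer r Real.pi = (1 - r) / (1 + r) := by
    rw [pKer, Real.cos_pi]
    have : 1 + r ≠ 0 := by positivity
    have h2 : 1 - 2 * r * -1 + r ^ 2 = (1 + r) * (1 + r) := by ring
    rw [h2, div_eq_div_iff (mul_ne_zero this this) this]; ring
  have hpi' : pKer r (-Real.pi) = (1 - r) / (1 + r) := by rw [← hpi]; simp [pKer]
  simp only [Pi.mul_apply, hp, hpi, hpi', id] at h
  linarith

theorem id_mul_qKer_nonneg {r s : ℝ} (h0 : 0 ≤ r) (h1 : r < 1) (hs : |s| ≤ Real.pi) :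
    0 ≤ s * qKer r s := by
  have h2 : 0 ≤ s * Real.sin s := by
    rcases le_total 0 s with h | h
    · exact mul_nonneg h (Real.sin_nonneg_of_nonneg_of_le_pi h ((le_abs_self s).trans hs))
    · exact mul_nonneg_of_nonpos_of_nonpos h
        (Real.sin_nonpos_of_nonpos_of_neg_pi_le h (by linarith [neg_le_abs s]))
  have e : s * qKer r s = (1 - r ^ 2) * (2 * r) * (s * Real.sin s) /
      (1 - 2 * r * Real.cos s + r ^ 2) ^ 2 := by rw [qKer]; ring
  rw [e]
  have : 0 ≤ 1 - r ^ 2 := by nlinarith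
  positivity

/-- The denominator base is `(1 - r)² + 2r(1 - cos s)`, which is at least `1 - cos δ` once `2r ≥ 1`.
The remaining factor `1 - r²` makes the kernel vanish uniformly away from `0`. -/
theorem abs_qKer_le {r s δ : ℝ} (h0 : 1 / 2 ≤ r) (h1 : r < 1) (hδ : 0 < δ) (hs : |s| ≤ Real.pi)
    (hδs : δ ≤ |s|) : |qKer r s| ≤ (1 - r ^ 2) * (2 / (1 - Real.cos δ) ^ 2) := by
  have hc : Real.cos s ≤ Real.cos δ := by
    rw [← Real.cos_abs s]
    exact Real.cos_le_cos_of_nonneg_of_le_pi hδ.le hs hδs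
  have hη : 0 < 1 - Real.cos δ := by
    have : Real.cos δ < Real.cos 0 :=
      Real.cos_lt_cos_of_nonneg_of_le_pi le_rfl (hδs.trans hs) hδ
    rw [Real.cos_zero] at this; linarith
  have hD : 1 - Real.cos δ ≤ 1 - 2 * r * Real.cos s + r ^ 2 := by
    nlinarith [sq_nonneg (1 - r), mul_nonneg (sub_nonneg.2 h0) (sub_nonneg.2 (Real.cos_le_one s))]
  have h2 : 0 ≤ 1 - r ^ 2 := by nlinarith
  rw [qKer, abs_div, abs_mul, abs_mul, abs_of_nonneg h2, abs_of_nonneg (by linarith : 0 ≤ 2 * r),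
    abs_of_nonneg (by positivity : 0 ≤ (1 - 2 * r * Real.cos s + r ^ 2) ^ 2), mul_div_assoc]
  gcongr
  nlinarith [Real.abs_sin_le_one s, abs_nonneg (Real.sin s)]

/-- The kernels `qKer r` annihilate, as `r ↑ 1`, continuous functions that are `o(s)` at `0`. -/
theorem tendsto_integral_mul_qKer {H : ℝ → ℂ} (hH : Continuous H)
    (ho : H =o[𝓝 0] fun s : ℝ => s) :
    Tendsto (fun r : ℝ => ∫ s in -Real.pi..Real.pi, H s * (qKer r s : ℂ)) (𝓝[<] 1) (𝓝 0) := by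
  have hpi := Real.pi_pos
  obtain ⟨B, hB⟩ := (isCompact_Icc (a := -Real.pi) (b := Real.pi)).exists_bound_of_continuousOn
    hH.continuousOn
  have hB0 : 0 ≤ B := (norm_nonneg _).trans (hB 0 ⟨by linarith, hpi.le⟩)
  rw [Metric.tendsto_nhds]
  intro ε hε
  -- Near `0` the integrand is at most `ε / (4π)` times `s * qKer r s`, whose integral is at most
  -- `2π`; this costs `ε / 2`. Away from `0` the bound `(1 - r²) c` tends to `0`.
  have hε' : 0 < ε / (4 * Real.pi) := by positivity
  obtain ⟨δ, hδ, hδ'⟩ := Metric.eventually_nhds_iff.1 (ho.def hε')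
  set c : ℝ := B * (2 / (1 - Real.cos δ) ^ 2) with hc
  have hlim : Tendsto (fun r : ℝ => (1 - r ^ 2) * c * (2 * Real.pi)) (𝓝[<] 1) (𝓝 0) := by
    have : Tendsto (fun r : ℝ => (1 - r ^ 2) * c * (2 * Real.pi)) (𝓝 1)
        (𝓝 ((1 - 1 ^ 2) * c * (2 * Real.pi))) := Continuous.tendsto (by fun_prop) 1
    simpa using this.mono_left nhdsWithin_le_nhds
  have hhalf : ∀ᶠ r : ℝ in 𝓝[<] 1, 1 / 2 ≤ r :=
    (eventually_ge_nhds (by norm_num)).filter_mono nhdsWithin_le_nhds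
  filter_upwards [hhalf, self_mem_nhdsWithin, hlim.eventually_lt_const (half_pos hε)]
    with r hr hr1 hr2
  have hr1 : r < 1 := hr1
  have hr0 : 0 ≤ r := by linarith
  have hQ := continuous_qKer hr0 hr1
  rw [dist_zero_right]
  have hb : ∀ s ∈ Set.Icc (-Real.pi) Real.pi, ‖H s * (qKer r s : ℂ)‖ ≤
      ε / (4 * Real.pi) * (s * qKer r s) + (1 - r ^ 2) * c := by
    intro s hs
    have hs' : |s| ≤ Real.pi := abs_le.2 hs
    have h2 : 0 ≤ 1 - r ^ 2 := by nlinarith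
    have hsq := id_mul_qKer_nonneg hr0 hr1 hs'
    rw [norm_mul, Complex.norm_real, Real.norm_eq_abs]
    by_cases h : |s| < δ
    · have h3 := hδ' (y := s) (by simpa using h)
      rw [Real.norm_eq_abs] at h3
      have h4 : 0 ≤ (1 - r ^ 2) * c := by positivity
      have h5 : |s| * |qKer r s| = s * qKer r s := by rw [← abs_mul, abs_of_nonneg hsq]
      have h6 := mul_le_mul_of_nonneg_right h3 (abs_nonneg (qKer r s))
      rw [mul_assoc, h5] at h6
      linarith
    · have h3 := mul_le_mul (hB s hs) (abs_qKer_le hr hr1 hδ hs' (not_lt.1 h)) (abs_nonneg _) hB0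
      have h4 : 0 ≤ ε / (4 * Real.pi) * (s * qKer r s) := by positivity
      have h5 : B * ((1 - r ^ 2) * (2 / (1 - Real.cos δ) ^ 2)) = (1 - r ^ 2) * c := by
        rw [hc]; ring
      linarith
  have h7 := intervalIntegral.norm_integral_le_of_norm_le (μ := volume)
    (f := fun s : ℝ => H s * (qKer r s : ℂ)) (by linarith : -Real.pi ≤ Real.pi)
    (Eventually.of_forall fun s hs => hb s ⟨hs.1.le, hs.2⟩)
    (by apply Continuous.intervalIntegrable; fun_prop)
  refine h7.trans_lt ?_
  rw [intervalIntegral.integral_add (by apply Continuous.intervalIntegrable; fun_prop)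
    (by apply Continuous.intervalIntegrable; fun_prop), intervalIntegral.integral_const_mul,
    integral_id_mul_qKer hr0 hr1, intervalIntegral.integral_const, smul_eq_mul]
  have h8 : ε / (4 * Real.pi) * (2 * Real.pi - 2 * Real.pi * ((1 - r) / (1 + r))) ≤ ε / 2 := by
    have h9 : 0 ≤ (1 - r) / (1 + r) := div_nonneg (by linarith) (by linarith)
    have : ε / (4 * Real.pi) * (2 * Real.pi - 2 * Real.pi * ((1 - r) / (1 + r))) =
        ε / 2 * (1 - (1 - r) / (1 + r)) := by field_simp; ring
    rw [this]
    nlinarith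
  have e : (Real.pi - -Real.pi) * ((1 - r ^ 2) * c) = (1 - r ^ 2) * c * (2 * Real.pi) := by ring
  rw [e]
  linarith

/-- Differentiating an absolutely convergent Fourier series term by term gives a series that is
Abel summable to the derivative, at every point of differentiability. -/
theorem tendsto_tsum_of_hasDerivAt {b : ℕ → ℂ} (hb : Summable fun n => ‖b n‖) {θ : ℝ} {k : ℂ}
    (hk : HasDerivAt (fun x : ℝ => ∑' n : ℕ, b n * Complex.exp (n * x * Complex.I)) k θ) :
    Tendsto (fun r : ℝ => ∑' n : ℕ,
      b n * (n * Complex.I) * (r : ℂ) ^ n * Complex.exp (n * θ * Complex.I)) (𝓝[<] 1) (𝓝 k) := by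
  set K : ℝ → ℂ := fun x => ∑' n : ℕ, b n * Complex.exp (n * x * Complex.I) with hK
  have hnorm : ∀ (n : ℕ) (x : ℝ), ‖Complex.exp (n * x * Complex.I)‖ = 1 := by
    intro n x
    have := Complex.norm_exp_ofReal_mul_I (n * x)
    push_cast at this
    exact this
  have hKc : Continuous K := by
    refine continuous_tsum (fun n => by fun_prop) hb fun n x => ?_
    rw [norm_mul, hnorm, mul_one]
  have hKs : ∀ x : ℝ, HasSum (fun n : ℕ => b n * Complex.exp (n * x * Complex.I)) (K x) := by
    intro x
    refine (Summable.of_norm ?_).hasSum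
    simpa only [norm_mul, hnorm, mul_one] using hb
  -- Pairing a translate of `K` with `qKer r` multiplies the `n`-th term by `n i rⁿ`: this is
  -- differentiation damped by the Abel factor.
  have hrep : ∀ r : ℝ, 0 ≤ r → r < 1 → ∫ s in -Real.pi..Real.pi, K (θ + s) * (qKer r s : ℂ) =
      2 * Real.pi * ∑' n : ℕ,
        b n * (n * Complex.I) * (r : ℂ) ^ n * Complex.exp (n * θ * Complex.I) := by
    intro r h0 h1
    have hQ := continuous_qKer h0 h1
    obtain ⟨B, hB⟩ := (isCompact_Icc (a := -Real.pi) (b := Real.pi)).exists_bound_of_continuousOn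
      hQ.continuousOn
    have hpi := Real.pi_pos
    have h := intervalIntegral.hasSum_integral_of_dominated_convergence (μ := volume)
      (a := -Real.pi) (b := Real.pi)
      (F := fun (n : ℕ) (s : ℝ) => b n * Complex.exp (n * ((θ + s : ℝ) : ℂ) * Complex.I) *
        (qKer r s : ℂ)) (f := fun s => K (θ + s) * (qKer r s : ℂ))
      (fun n _ => ‖b n‖ * B)
      (fun n => Continuous.aestronglyMeasurable (by fun_prop))
      (fun n => Eventually.of_forall fun s hs => by
        rw [norm_mul, norm_mul, hnorm, mul_one, Complex.norm_real]
        rw [Set.uIoc_of_le (by linarith)] at hs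
        exact mul_le_mul_of_nonneg_left (hB s ⟨hs.1.le, hs.2⟩) (norm_nonneg _))
      (Eventually.of_forall fun s _ => hb.mul_right B)
      (by simp)
      (Eventually.of_forall fun s _ => (hKs (θ + s)).mul_right _)
    rw [← h.tsum_eq, ← tsum_mul_left]
    congr 1
    funext n
    have e : ∀ s : ℝ, b n * Complex.exp (n * ((θ + s : ℝ) : ℂ) * Complex.I) * (qKer r s : ℂ) =
        b n * Complex.exp (n * θ * Complex.I) *
          ((qKer r s : ℂ) * Complex.exp (n * s * Complex.I)) := by
      intro s
      have : (n : ℂ) * ((θ + s : ℝ) : ℂ) * Complex.I = n * θ * Complex.I + n * s * Complex.I := by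
        push_cast; ring
      rw [this, Complex.exp_add]; ring
    simp only [e]
    rw [intervalIntegral.integral_const_mul, integral_qKer_mul_cexp h0 h1]
    ring
  -- Subtract the tangent line. The kernel kills the constant `K θ`, the linear part contributes `k`
  -- times a mass tending to `2π`, and the remainder is `o(s)`.
  set H : ℝ → ℂ := fun s => K (θ + s) - K θ - k * s with hH
  have hHc : Continuous H := by fun_prop
  have hHo : H =o[𝓝 0] fun s : ℝ => s := by
    have := hasDerivAt_iff_isLittleO_nhds_zero.1 hk
    refine this.congr_left fun s => ?_
    simp only [hH, Complex.real_smul]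
    ring
  have h1 := tendsto_integral_mul_qKer hHc hHo
  have h2 : Tendsto (fun r : ℝ => k * (2 * Real.pi - 2 * Real.pi * ((1 - r) / (1 + r)) : ℝ))
      (𝓝[<] 1) (𝓝 (k * (2 * Real.pi - 2 * Real.pi * ((1 - 1) / (1 + 1)) : ℝ))) := by
    have hc : ContinuousAt
        (fun r : ℝ => k * (2 * Real.pi - 2 * Real.pi * ((1 - r) / (1 + r)) : ℝ)) 1 := by
      refine continuousAt_const.mul (Complex.continuous_ofReal.continuousAt.comp ?_)
      refine continuousAt_const.sub (continuousAt_const.mul ?_)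
      exact ContinuousAt.div (by fun_prop) (by fun_prop) (by norm_num)
    exact hc.tendsto.mono_left nhdsWithin_le_nhds
  have h3 := (h1.add h2).const_mul ((2 * Real.pi : ℂ)⁻¹)
  have hpi : (2 * Real.pi : ℂ) ≠ 0 := by
    simp [Real.pi_ne_zero]
  have e4 : (2 * Real.pi : ℂ)⁻¹ *
      (0 + k * (2 * Real.pi - 2 * Real.pi * ((1 - 1) / (1 + 1)) : ℝ)) = k := by
    push_cast
    rw [sub_self, zero_div, mul_zero, sub_zero, zero_add]
    field_simp
  rw [e4] at h3
  refine h3.congr' ?_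
  have hpos : ∀ᶠ r : ℝ in 𝓝[<] 1, 0 ≤ r :=
    (eventually_ge_nhds (by norm_num)).filter_mono nhdsWithin_le_nhds
  filter_upwards [hpos, self_mem_nhdsWithin] with r hr0 hr1
  have hr1 : r < 1 := hr1
  have hQ := continuous_qKer hr0 hr1
  rw [inv_mul_eq_iff_eq_mul₀ hpi, ← hrep r hr0 hr1, ← integral_id_mul_qKer hr0 hr1,
    ← intervalIntegral.integral_ofReal, ← intervalIntegral.integral_const_mul,
    ← intervalIntegral.integral_add (by apply Continuous.intervalIntegrable; fun_prop)
    (by apply Continuous.intervalIntegrable; fun_prop)]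
  have e5 : ∀ s : ℝ, H s * (qKer r s : ℂ) + k * ((s * qKer r s : ℝ) : ℂ) =
      K (θ + s) * (qKer r s : ℂ) - K θ * (qKer r s : ℂ) := by
    intro s; simp only [hH]; push_cast; ring
  simp only [e5]
  have hq0 : ∫ s in -Real.pi..Real.pi, (qKer r s : ℂ) = 0 := by
    have := integral_qKer_mul_cexp hr0 hr1 0
    simpa using this
  rw [intervalIntegral.integral_sub (by apply Continuous.intervalIntegrable; fun_prop)
    (by apply Continuous.intervalIntegrable; fun_prop), intervalIntegral.integral_const_mul, hq0,
    mul_zero, sub_zero]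

/-! ### Radial limits of power series with square summable coefficients -/

theorem fact_two_pi_pos : Fact (0 < 2 * Real.pi) := ⟨Real.two_pi_pos⟩

attribute [local instance] fact_two_pi_pos

theorem fourier_two_pi_apply (n : ℤ) (θ : ℝ) :
    fourier n (θ : AddCircle (2 * Real.pi)) = Complex.exp (n * θ * Complex.I) := by
  rw [fourier_coe_apply]
  congr 1
  push_cast
  have : (Real.pi : ℂ) ≠ 0 := by simp [Real.pi_ne_zero]
  field_simp

/-- The arc of the circle that corresponds to the interval `(a, b]`. -/
def arc (a b : ℝ) : Set (AddCircle (2 * Real.pi)) :=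
  {x | (AddCircle.equivIoc (2 * Real.pi) a x : ℝ) ≤ b}

theorem measurableSet_arc (a b : ℝ) : MeasurableSet (arc a b) :=
  measurableSet_le (measurable_subtype_coe.comp
    (AddCircle.measurableEquivIoc (2 * Real.pi) a).measurable) measurable_const

theorem setIntegral_arc {a b : ℝ} (hab : a ≤ b) (hb : b ≤ a + 2 * Real.pi)
    (h : AddCircle (2 * Real.pi) → ℂ) :
    ∫ x in arc a b, h x ∂AddCircle.haarAddCircle =
      ((2 * Real.pi)⁻¹ : ℝ) • ∫ t in a..b, h (t : AddCircle (2 * Real.pi)) := by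
  rw [← integral_indicator (measurableSet_arc a b), AddCircle.integral_haarAddCircle,
    ← AddCircle.integral_preimage (2 * Real.pi) a, intervalIntegral.integral_of_le hab]
  congr 1
  have e : ∀ t ∈ Set.Ioc a (a + 2 * Real.pi),
      (arc a b).indicator h (t : AddCircle (2 * Real.pi)) =
      (Set.Ioc a b).indicator (fun t : ℝ => h (t : AddCircle (2 * Real.pi))) t := by
    intro t ht
    have hm : ((t : AddCircle (2 * Real.pi)) ∈ arc a b) ↔ t ∈ Set.Ioc a b := by
      rw [arc, Set.mem_ofPred_eq, AddCircle.equivIoc_coe_eq ht]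
      exact ⟨fun h => ⟨ht.1, h⟩, fun h => h.2⟩
    by_cases h' : t ∈ Set.Ioc a b
    · rw [Set.indicator_of_mem h', Set.indicator_of_mem (hm.2 h')]
    · rw [Set.indicator_of_notMem h', Set.indicator_of_notMem (fun h2 => h' (hm.1 h2))]
  rw [setIntegral_congr_fun measurableSet_Ioc e, setIntegral_indicator measurableSet_Ioc,
    Set.inter_eq_right.2 (Set.Ioc_subset_Ioc_right hb)]

/-- The sequence on `ℤ` that extends `a` by `0`. -/
def extendZero (a : ℕ → ℂ) (n : ℤ) : ℂ := if 0 ≤ n then a n.toNat else 0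

theorem extendZero_natCast (a : ℕ → ℂ) (n : ℕ) : extendZero a n = a n := by
  simp [extendZero]

theorem extendZero_of_notMem (a : ℕ → ℂ) {n : ℤ} (hn : n ∉ Set.range ((↑) : ℕ → ℤ)) :
    extendZero a n = 0 := by
  rw [extendZero, if_neg]
  exact fun h => hn ⟨n.toNat, Int.toNat_of_nonneg h⟩

theorem exists_Lp_of_summable_sq {a : ℕ → ℂ} (ha : Summable fun n => ‖a n‖ ^ 2) :
    ∃ g : Lp ℂ 2 (AddCircle.haarAddCircle (T := 2 * Real.pi)),
      ∀ n : ℤ, fourierCoeff g n = extendZero a n := by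
  have h : Memℓp (extendZero a) 2 := by
    rw [memℓp_gen_iff (by norm_num)]
    refine (Function.Injective.summable_iff (Nat.cast_injective (R := ℤ)) ?_).1 ?_
    · intro n hn
      rw [extendZero_of_notMem a hn]
      norm_num
    · simpa [Function.comp_def, extendZero_natCast] using ha
  refine ⟨fourierBasis.repr.symm ⟨extendZero a, h⟩, fun n => ?_⟩
  rw [← fourierBasis_repr, LinearIsometryEquiv.apply_symm_apply]

theorem integral_cexp_nat {n : ℕ} (hn : n ≠ 0) (x y : ℝ) :
    ∫ t in x..y, Complex.exp (n * t * Complex.I) =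
      (Complex.exp (n * y * Complex.I) - Complex.exp (n * x * Complex.I)) / (n * Complex.I) := by
  have hne : (n : ℂ) * Complex.I ≠ 0 := by simp [hn]
  have e : ∀ t : ℝ, (n : ℂ) * t * Complex.I = n * Complex.I * t := fun t => by ring
  simp only [e]
  exact integral_exp_mul_complex hne

/-- A square summable sequence of Taylor coefficients gives a function with radial limits a.e. that
are integrable and have the given Fourier coefficients. -/
theorem exists_radial_limit {a : ℕ → ℂ} (ha0 : a 0 = 0) (ha : Summable fun n => ‖a n‖ ^ 2) :
    ∃ G : ℝ → ℂ, (∀ x y : ℝ, IntervalIntegrable G volume x y) ∧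
      (∀ᵐ θ : ℝ, Tendsto (fun r : ℝ => ∑' n : ℕ,
        a n * (r : ℂ) ^ n * Complex.exp (n * θ * Complex.I)) (𝓝[<] 1) (𝓝 (G θ))) ∧
      ∀ n : ℤ, ∫ θ in 0..2 * Real.pi, Complex.exp (-(n * θ * Complex.I)) * G θ =
        2 * Real.pi * extendZero a n := by
  obtain ⟨g, hg⟩ := exists_Lp_of_summable_sq ha
  set G : ℝ → ℂ := fun θ => g (θ : AddCircle (2 * Real.pi)) with hG
  have hgi : Integrable g (AddCircle.haarAddCircle (T := 2 * Real.pi)) :=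
    (Lp.memLp g).integrable (by norm_num)
  have hgv : Integrable g (volume : Measure (AddCircle (2 * Real.pi))) := by
    rw [AddCircle.volume_eq_smul_haarAddCircle]
    exact hgi.smul_measure ENNReal.ofReal_ne_top
  have hint0 : IntervalIntegrable G volume 0 (0 + 2 * Real.pi) := by
    rw [intervalIntegrable_iff_integrableOn_Ioc_of_le (by linarith [Real.pi_pos])]
    exact (AddCircle.measurePreserving_mk (2 * Real.pi) 0).integrable_comp_of_integrable hgv
  have hper : Function.Periodic G (2 * Real.pi) := by
    intro θ
    simp only [hG, AddCircle.coe_add, AddCircle.coe_period, add_zero]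
  have hint : ∀ x y : ℝ, IntervalIntegrable G volume x y := by
    intro x y
    rw [zero_add] at hint0
    exact hper.intervalIntegrable₀ Real.two_pi_pos.ne' hint0 x y
  have hloc : LocallyIntegrable G volume := by
    intro x
    refine ⟨Set.Ioc (x - 1) (x + 1), Ioc_mem_nhds (by linarith) (by linarith), ?_⟩
    exact (intervalIntegrable_iff_integrableOn_Ioc_of_le (by linarith)).1 (hint _ _)
  -- These are the coefficients of the primitive. At `n = 0` the division by zero returns `0`, which
  -- is harmless since `a 0 = 0`. Absolute convergence follows from `2 |a n| / n ≤ |a n|² + 1 / n²`.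
  set b : ℕ → ℂ := fun n => a n / (n * Complex.I) with hbdef
  have hb : Summable fun n => ‖b n‖ := by
    have h2 : Summable fun n : ℕ => 1 / (n : ℝ) ^ 2 :=
      Real.summable_one_div_nat_pow.2 (by norm_num)
    refine Summable.of_nonneg_of_le (fun n => norm_nonneg _) (fun n => ?_) (ha.add h2)
    simp only [hbdef, norm_div, norm_mul, Complex.norm_I, mul_one, Complex.norm_natCast]
    have := two_mul_le_add_sq ‖a n‖ (1 / (n : ℝ))
    have h3 : 0 ≤ ‖a n‖ * (1 / (n : ℝ)) := by positivity
    rw [div_pow, one_pow] at this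
    calc ‖a n‖ / n = ‖a n‖ * (1 / (n : ℝ)) := by ring
      _ ≤ _ := by linarith
  set K : ℝ → ℂ := fun x => ∑' n : ℕ, b n * Complex.exp (n * x * Complex.I) with hK
  have hKs : ∀ x : ℝ, HasSum (fun n : ℕ => b n * Complex.exp (n * x * Complex.I)) (K x) := by
    intro x
    refine (Summable.of_norm ?_).hasSum
    have hnorm : ∀ n : ℕ, ‖Complex.exp (n * x * Complex.I)‖ = 1 := by
      intro n
      have := Complex.norm_exp_ofReal_mul_I (n * x)
      push_cast at this
      exact this
    simpa only [norm_mul, hnorm, mul_one] using hb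
  -- Pairing the `L²`-convergent Fourier series of `g` with the indicator of an arc integrates it
  -- term by term. An arc covers at most one turn, hence the restriction on `y`.
  have hprim : ∀ x y : ℝ, x ≤ y → y ≤ x + 2 * Real.pi → ∫ t in x..y, G t = K y - K x := by
    intro x y hxy hy
    have h1 := hasSum_fourier_series_L2 g
    have hfin : AddCircle.haarAddCircle (arc x y) ≠ ⊤ := measure_ne_top _ _
    have h2 := h1.mapL (innerSL ℂ (indicatorConstLp 2 (measurableSet_arc x y) hfin (1 : ℂ)))
    simp only [innerSL_apply_apply, inner_smul_right, L2.inner_indicatorConstLp_one, hg] at h2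
    rw [setIntegral_arc hxy hy] at h2
    have h3 : ∀ n : ℤ, ∫ t in arc x y, (fourierLp 2 n : AddCircle (2 * Real.pi) → ℂ) t
        ∂AddCircle.haarAddCircle =
        ((2 * Real.pi)⁻¹ : ℝ) • ∫ t in x..y, Complex.exp (n * t * Complex.I) := by
      intro n
      rw [setIntegral_congr_ae (g := fourier n) (measurableSet_arc x y)
        ((coeFn_fourierLp 2 n).mono fun t ht _ => ht), setIntegral_arc hxy hy]
      simp only [fourier_two_pi_apply]
    simp only [h3] at h2
    rw [← Function.Injective.hasSum_iff (Nat.cast_injective (R := ℤ))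
      (by intro n hn; rw [extendZero_of_notMem a hn, zero_mul])] at h2
    have h4 := h2.const_smul (2 * Real.pi : ℝ)
    have h5 := (hKs y).sub (hKs x)
    rw [smul_inv_smul₀ (by positivity)] at h4
    refine HasSum.unique (h4.congr_fun ?_) h5
    intro n
    simp only [Function.comp_apply, extendZero_natCast, Int.cast_natCast, hbdef]
    by_cases hn : n = 0
    · simp [hn, ha0]
    · rw [integral_cexp_nat hn, mul_smul_comm, smul_inv_smul₀ (by positivity)]
      ring
  have hae := LocallyIntegrable.ae_hasDerivAt_integral hloc
  refine ⟨G, hint, ?_, ?_⟩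
  · filter_upwards [hae] with θ hθ
    -- The base point `θ - 1` keeps every `y` near `θ` within one period, so `hprim` identifies the
    -- integral with `K` up to a constant.
    have hd := hθ (θ - 1)
    have hKd : HasDerivAt K (G θ) θ := by
      have h2 := hd.const_add (K (θ - 1))
      refine h2.congr_of_eventuallyEq ?_
      filter_upwards [Icc_mem_nhds (show θ - 1 < θ by linarith) (show θ < θ + 1 by linarith)]
        with y hy
      rw [hprim _ _ hy.1 (by linarith [hy.2, Real.pi_gt_three])]
      ring
    have h := tendsto_tsum_of_hasDerivAt hb hKd
    refine h.congr fun r => ?_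
    congr 1
    funext n
    by_cases hn : n = 0
    · simp [hn, ha0]
    · have hn' : (n : ℂ) * Complex.I ≠ 0 := by simp [hn]
      simp only [hbdef]
      rw [div_mul_cancel₀ _ hn']
  · intro n
    have h := fourierCoeff_eq_intervalIntegral (T := 2 * Real.pi) g n 0
    rw [hg, zero_add] at h
    have e : ∀ θ : ℝ, fourier (-n) (θ : AddCircle (2 * Real.pi)) • g θ =
        Complex.exp (-(n * θ * Complex.I)) * G θ := by
      intro θ
      rw [fourier_two_pi_apply, smul_eq_mul]
      congr 2
      push_cast; ring
    simp only [e] at h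
    have hpi : (2 * Real.pi : ℂ) ≠ 0 := by simp [Real.pi_ne_zero]
    rw [h, Complex.real_smul]
    push_cast
    rw [← mul_assoc, mul_one_div_cancel hpi, one_mul]

/-! ### A boundedness criterion for membership in `H²` -/

theorem integral_cexp_neg_mul_cexp (n k : ℤ) :
    ∫ θ in 0..2 * Real.pi, Complex.exp (-(n * θ * Complex.I)) * Complex.exp (k * θ * Complex.I) =
      if k = n then 2 * (Real.pi : ℂ) else 0 := by
  have e : ∀ θ : ℝ, Complex.exp (-(n * θ * Complex.I)) * Complex.exp (k * θ * Complex.I) =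
      Complex.exp (((k - n : ℤ) : ℂ) * Complex.I * θ) := by
    intro θ
    rw [← Complex.exp_add]
    congr 1
    push_cast; ring
  simp only [e]
  split_ifs with h
  · simp [h]
  · have hn' : ((k - n : ℤ) : ℂ) * Complex.I ≠ 0 := by
      simp only [ne_eq, mul_eq_zero, Int.cast_eq_zero, Complex.I_ne_zero, or_false]
      omega
    rw [integral_exp_mul_complex hn']
    have e2 : ((k - n : ℤ) : ℂ) * Complex.I * (2 * Real.pi : ℝ) =
        ((k - n : ℤ) : ℂ) * (2 * Real.pi * Complex.I) := by push_cast; ring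
    rw [e2, Complex.exp_int_mul_two_pi_mul_I]
    simp

theorem continuous_comp_circleMap {f : ℂ → ℂ} (hf : ContinuousOn f (Metric.ball 0 1)) {r : ℝ}
    (hr0 : 0 ≤ r) (hr1 : r < 1) : Continuous fun θ : ℝ => f (circleMap 0 r θ) := by
  refine hf.comp_continuous (continuous_circleMap 0 r) fun θ => ?_
  simp [abs_of_nonneg hr0, hr1]

/-- A function that is the sum of a power series in the disk has the expected Fourier coefficients
on the circles about the origin. -/
theorem integral_cexp_mul_comp_circleMap {f : ℂ → ℂ} {a : ℕ → ℂ}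
    (hfa : ∀ z ∈ Metric.ball (0 : ℂ) 1, HasSum (fun n => a n * z ^ n) (f z)) {r : ℝ}
    (hr0 : 0 ≤ r) (hr1 : r < 1) (n : ℕ) :
    ∫ θ in 0..2 * Real.pi, Complex.exp (-(n * θ * Complex.I)) * f (circleMap 0 r θ) =
      2 * Real.pi * (a n * (r : ℂ) ^ n) := by
  have hrmem : (r : ℂ) ∈ Metric.ball (0 : ℂ) 1 := by simp [abs_of_nonneg hr0, hr1]
  have hsum := (hfa _ hrmem).summable.norm
  have hnorm : ∀ (k : ℕ) (θ : ℝ), ‖Complex.exp (k * θ * Complex.I)‖ = 1 := by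
    intro k θ
    have := Complex.norm_exp_ofReal_mul_I (k * θ)
    push_cast at this
    exact this
  have hpow : ∀ (k : ℕ) (θ : ℝ), circleMap 0 r θ ^ k =
      (r : ℂ) ^ k * Complex.exp (k * θ * Complex.I) := by
    intro k θ
    simp [circleMap, mul_pow, ← Complex.exp_nat_mul, mul_assoc]
  have h := intervalIntegral.hasSum_integral_of_dominated_convergence (μ := volume)
    (a := 0) (b := 2 * Real.pi)
    (F := fun (k : ℕ) (θ : ℝ) => Complex.exp (-(n * θ * Complex.I)) *
      (a k * (r : ℂ) ^ k * Complex.exp (k * θ * Complex.I)))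
    (f := fun θ => Complex.exp (-(n * θ * Complex.I)) * f (circleMap 0 r θ))
    (fun k _ => ‖a k * (r : ℂ) ^ k‖)
    (fun k => Continuous.aestronglyMeasurable (by fun_prop))
    (fun k => Eventually.of_forall fun θ _ => by
      rw [norm_mul, norm_mul _ (Complex.exp _), hnorm, mul_one, Complex.exp_neg, norm_inv, hnorm,
        inv_one, one_mul])
    (Eventually.of_forall fun θ _ => hsum)
    (by simp)
    (Eventually.of_forall fun θ _ => by
      have h2 := hfa (circleMap 0 r θ) (by simp [abs_of_nonneg hr0, hr1])
      simp only [hpow, ← mul_assoc] at h2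
      simpa only [mul_assoc] using h2.mul_left (Complex.exp (-(n * θ * Complex.I))))
  have e : ∀ (k : ℕ), ∫ θ in 0..2 * Real.pi, Complex.exp (-(n * θ * Complex.I)) *
      (a k * (r : ℂ) ^ k * Complex.exp (k * θ * Complex.I)) =
      if k = n then 2 * Real.pi * (a n * (r : ℂ) ^ n) else 0 := by
    intro k
    have e1 : ∀ θ : ℝ, Complex.exp (-(n * θ * Complex.I)) *
      (a k * (r : ℂ) ^ k * Complex.exp (k * θ * Complex.I)) = a k * (r : ℂ) ^ k *
        (Complex.exp (-(n * θ * Complex.I)) * Complex.exp (k * θ * Complex.I)) := by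
      intro θ; ring
    simp only [e1]
    rw [intervalIntegral.integral_const_mul]
    have h3 := integral_cexp_neg_mul_cexp n k
    simp only [Int.cast_natCast, Nat.cast_inj] at h3
    rw [h3]
    split_ifs with h4
    · rw [h4]; ring
    · rw [mul_zero]
  simp only [e] at h
  exact h.unique (hasSum_ite_eq n _)

/-- If `f - conj g` is bounded in the disk, for analytic `f`, `g` with `f 0 = 0`, then the
Taylor coefficients of `f` are square summable. -/
theorem summable_sq_of_norm_sub_conj_le {f g : ℂ → ℂ} {a : ℕ → ℂ}
    (hf : DifferentiableOn ℂ f (Metric.ball 0 1)) (hg : DifferentiableOn ℂ g (Metric.ball 0 1))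
    (hfa : ∀ z ∈ Metric.ball (0 : ℂ) 1, HasSum (fun n => a n * z ^ n) (f z)) (hf0 : f 0 = 0)
    {C : ℝ} (hC : ∀ z ∈ Metric.ball (0 : ℂ) 1, ‖f z - conj (g z)‖ ≤ C) :
    Summable fun n => ‖a n‖ ^ 2 := by
  have hpi := Real.two_pi_pos
  have hr : ∀ r : ℝ, 0 ≤ r → r < 1 → ∀ N : ℕ,
      ∑ n ∈ Finset.range N, ‖a n‖ ^ 2 * r ^ (2 * n) ≤ C ^ 2 := by
    intro r hr0 hr1 N
    have hfc := continuous_comp_circleMap hf.continuousOn hr0 hr1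
    have hgc := continuous_comp_circleMap hg.continuousOn hr0 hr1
    have hmem : ∀ θ : ℝ, circleMap 0 r θ ∈ Metric.ball (0 : ℂ) 1 := by
      intro θ; simp [abs_of_nonneg hr0, hr1]
    have hL2 : MemLp (fun θ : ℝ => f (circleMap 0 r θ)) 2
        (volume.restrict (Set.Ioc 0 (2 * Real.pi))) := by
      obtain ⟨B, hB⟩ := (isCompact_Icc (a := 0) (b := 2 * Real.pi)).exists_bound_of_continuousOn
        hfc.continuousOn
      refine MemLp.of_bound hfc.aestronglyMeasurable B ?_
      filter_upwards [ae_restrict_mem measurableSet_Ioc] with θ hθ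
      exact hB θ ⟨hθ.1.le, hθ.2⟩
    have hP := hasSum_sq_fourierCoeffOn hpi hL2
    have hcoef : ∀ n : ℕ, ‖fourierCoeffOn hpi (fun θ : ℝ => f (circleMap 0 r θ)) n‖ ^ 2 =
        ‖a n‖ ^ 2 * r ^ (2 * n) := by
      intro n
      have e : ∀ θ : ℝ, fourier (-n : ℤ) (θ : AddCircle (2 * Real.pi - 0)) •
          f (circleMap 0 r θ) = Complex.exp (-(n * θ * Complex.I)) * f (circleMap 0 r θ) := by
        intro θ
        rw [sub_zero, fourier_two_pi_apply, smul_eq_mul]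
        congr 2
        push_cast; ring
      have h2 : fourierCoeffOn hpi (fun θ : ℝ => f (circleMap 0 r θ)) n = a n * (r : ℂ) ^ n := by
        rw [fourierCoeffOn_eq_integral]
        simp only [e]
        have hpi' : (2 * Real.pi : ℂ) ≠ 0 := by simp [Real.pi_ne_zero]
        rw [integral_cexp_mul_comp_circleMap hfa hr0 hr1, Complex.real_smul, sub_zero]
        push_cast
        rw [← mul_assoc, one_div_mul_cancel hpi', one_mul]
      rw [h2, norm_mul, norm_pow, Complex.norm_real, Real.norm_eq_abs, abs_of_nonneg hr0]
      ring
    have h1 := sum_le_hasSum ((Finset.range N).map Nat.castEmbedding)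
      (fun n _ => sq_nonneg _) hP
    rw [Finset.sum_map] at h1
    simp only [Nat.castEmbedding_apply, hcoef] at h1
    refine h1.trans ?_
    -- The mean value property for the analytic function `f g`, which vanishes at `0`.
    have hfg : ∫ θ in 0..2 * Real.pi, f (circleMap 0 r θ) * g (circleMap 0 r θ) = 0 := by
      have hd : DiffContOnCl ℂ (fun z => f z * g z) (Metric.ball 0 |r|) := by
        refine ((hf.mul hg).mono ?_).diffContOnCl
        rw [abs_of_nonneg hr0]
        exact Metric.closure_ball_subset_closedBall.trans (Metric.closedBall_subset_ball hr1)
      have h := hd.circleAverage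
      rw [Real.circleAverage_def, hf0, zero_mul, smul_eq_zero] at h
      exact h.resolve_left (by positivity)
    have hre : ∫ θ in 0..2 * Real.pi, (f (circleMap 0 r θ) * g (circleMap 0 r θ)).re = 0 := by
      have := Complex.reCLM.intervalIntegral_comp_comm
        (μ := volume) ((hfc.mul hgc).intervalIntegrable 0 (2 * Real.pi))
      simp only [Pi.mul_apply, Complex.reCLM_apply] at this
      rw [this, hfg, Complex.zero_re]
    have hc2 : Continuous fun θ : ℝ => 2 * (f (circleMap 0 r θ) * g (circleMap 0 r θ)).re :=
      continuous_const.mul (Complex.continuous_re.comp (hfc.mul hgc))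
    -- Pointwise, `|f|² + |g|² = |f - conj g|² + 2 Re (f g)`; the term `|g|²` is dropped.
    have hle : ∫ θ in 0..2 * Real.pi, ‖f (circleMap 0 r θ)‖ ^ 2 ≤
        ∫ θ in 0..2 * Real.pi, (C ^ 2 + 2 * (f (circleMap 0 r θ) * g (circleMap 0 r θ)).re) := by
      refine intervalIntegral.integral_mono_on hpi.le ((hfc.norm.pow 2).intervalIntegrable _ _)
        ((continuous_const.add hc2).intervalIntegrable _ _) fun θ _ => ?_
      have h2 := pow_le_pow_left₀ (norm_nonneg _) (hC _ (hmem θ)) 2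
      simp only [← Complex.normSq_eq_norm_sq, Complex.normSq_apply, Complex.sub_re, Complex.sub_im,
        Complex.conj_re, Complex.conj_im, Complex.mul_re] at h2 ⊢
      nlinarith [sq_nonneg (g (circleMap 0 r θ)).re, sq_nonneg (g (circleMap 0 r θ)).im]
    rw [intervalIntegral.integral_add (continuous_const.intervalIntegrable _ _)
      (hc2.intervalIntegrable _ _), intervalIntegral.integral_const_mul, hre,
      intervalIntegral.integral_const, mul_zero, add_zero, sub_zero, smul_eq_mul] at hle
    rw [sub_zero, smul_eq_mul, inv_mul_le_iff₀ hpi]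
    exact hle
  refine summable_of_sum_range_le (c := C ^ 2) (fun n => sq_nonneg _) fun N => ?_
  have ht : Tendsto (fun r : ℝ => ∑ n ∈ Finset.range N, ‖a n‖ ^ 2 * r ^ (2 * n)) (𝓝[<] 1)
      (𝓝 (∑ n ∈ Finset.range N, ‖a n‖ ^ 2 * 1 ^ (2 * n))) :=
    (Continuous.tendsto (by fun_prop) 1).mono_left nhdsWithin_le_nhds
  simp only [one_pow, mul_one] at ht
  refine le_of_tendsto ht ?_
  have hpos : ∀ᶠ r : ℝ in 𝓝[<] 1, 0 ≤ r :=
    (eventually_ge_nhds (by norm_num)).filter_mono nhdsWithin_le_nhds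
  filter_upwards [hpos, self_mem_nhdsWithin] with r hr0 hr1
  exact hr r hr0 hr1 N

/-! ### Defect operators, unitarity of the blocks, and the inverse CMV operator -/

variable {m : ℕ} {α : ℤ → Mat m}

theorem one_sub_conjTranspose_mul_self_nonneg {a : Mat m} (ha : ‖a‖ ≤ 1) : 0 ≤ 1 - aᴴ * a := by
  refine sub_nonneg.2 ((CStarAlgebra.norm_le_one_iff_of_nonneg _ (star_mul_self_nonneg a)).1 ?_)
  have : ‖star a * a‖ = ‖a‖ * ‖a‖ := CStarRing.norm_star_mul_self
  rw [this]
  exact mul_le_one₀ ha (norm_nonneg _) ha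

open scoped ComplexOrder in
-- Multiply the equation by `Xᴴ` on the left and take traces: the traces of `Xᴴ S X` and `X R Xᴴ`
-- are nonnegative and add up to `0`. Hence `Xᴴ S X = 0`, so the square root of `S` annihilates `X`.
theorem eq_zero_of_sylvester {S R X : Mat m} (hS : 0 ≤ S) (hR : 0 ≤ R) (h : S * X + X * R = 0) :
    S * X = 0 ∧ X * R = 0 := by
  have hS' := Matrix.nonneg_iff_posSemidef.1 hS
  have hR' := Matrix.nonneg_iff_posSemidef.1 hR
  have h1 := hS'.conjTranspose_mul_mul_same X
  have h2 := hR'.mul_mul_conjTranspose_same X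
  have ht : (Xᴴ * S * X).trace + (X * R * Xᴴ).trace = 0 := by
    rw [Matrix.trace_mul_comm (X * R) Xᴴ, ← Matrix.trace_add, Matrix.mul_assoc, ← Matrix.mul_add, h,
      Matrix.mul_zero, Matrix.trace_zero]
  have t1 := h1.trace_nonneg
  have t2 := h2.trace_nonneg
  have t3 : (Xᴴ * S * X).trace = 0 := le_antisymm (by rw [← ht]; exact le_add_of_nonneg_right t2) t1
  have e1 : Xᴴ * S * X = 0 := h1.trace_eq_zero_iff.1 t3
  have hs : CFC.sqrt S * CFC.sqrt S = S := CFC.sqrt_mul_sqrt_self S hS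
  have hsa : (CFC.sqrt S)ᴴ = CFC.sqrt S :=
    (Matrix.nonneg_iff_posSemidef.1 (CFC.sqrt_nonneg S)).1
  have e2 : (CFC.sqrt S * X)ᴴ * (CFC.sqrt S * X) = 0 := by
    rw [Matrix.conjTranspose_mul, hsa, ← e1, Matrix.mul_assoc, ← Matrix.mul_assoc _ _ X, hs,
      Matrix.mul_assoc]
  have e3 := Matrix.conjTranspose_mul_self_eq_zero.1 e2
  have e4 : S * X = 0 := by rw [← hs, Matrix.mul_assoc, e3, Matrix.mul_zero]
  exact ⟨e4, by rwa [e4, zero_add] at h⟩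

open scoped ComplexOrder in
/-- `(1 - a a*)^{1/2} a = a (1 - a* a)^{1/2}` for a contraction `a`. -/
theorem sqrt_mul_eq_mul_sqrt {a : Mat m} (ha : ‖a‖ ≤ 1) :
    CFC.sqrt (1 - a * aᴴ) * a = a * CFC.sqrt (1 - aᴴ * a) := by
  set S := CFC.sqrt (1 - a * aᴴ) with hSdef
  set R := CFC.sqrt (1 - aᴴ * a) with hRdef
  have ha' : ‖aᴴ‖ ≤ 1 := (Matrix.l2_opNorm_conjTranspose a).trans_le ha
  have hp := one_sub_conjTranspose_mul_self_nonneg ha'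
  rw [Matrix.conjTranspose_conjTranspose] at hp
  have hS2 : S * S = 1 - a * aᴴ := CFC.sqrt_mul_sqrt_self _ hp
  have hR2 : R * R = 1 - aᴴ * a :=
    CFC.sqrt_mul_sqrt_self _ (one_sub_conjTranspose_mul_self_nonneg ha)
  have hSa : Sᴴ = S := (Matrix.nonneg_iff_posSemidef.1 (CFC.sqrt_nonneg _)).1
  have hRa : Rᴴ = R := (Matrix.nonneg_iff_posSemidef.1 (CFC.sqrt_nonneg _)).1
  -- The defect `X` of the intertwining relation solves a homogeneous Sylvester equation, since `(1
  -- - a aᴴ) a = a (1 - aᴴ a)`.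
  set X := S * a - a * R with hX
  have h : S * X + X * R = 0 := by
    have : S * X + X * R = S * S * a - a * (R * R) := by rw [hX]; noncomm_ring
    rw [this, hS2, hR2]
    noncomm_ring
  obtain ⟨h1, h2⟩ := eq_zero_of_sylvester (CFC.sqrt_nonneg _) (CFC.sqrt_nonneg _) h
  -- From `X R = 0` and `S X = 0` the Hermitian matrix `X Xᴴ` has square `0`, so `X = 0`. No
  -- invertibility of `S` or `R` is needed.
  have e1 : X * Xᴴ = X * aᴴ * S := by
    have : Xᴴ = aᴴ * S - R * aᴴ := by
      rw [hX, Matrix.conjTranspose_sub, Matrix.conjTranspose_mul, Matrix.conjTranspose_mul, hSa, hRa]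
    rw [this, Matrix.mul_sub, ← Matrix.mul_assoc X R, h2, Matrix.zero_mul, sub_zero,
      Matrix.mul_assoc]
  have e2 : (X * Xᴴ)ᴴ * (X * Xᴴ) = 0 := by
    have : (X * Xᴴ)ᴴ = X * Xᴴ := by
      rw [Matrix.conjTranspose_mul, Matrix.conjTranspose_conjTranspose]
    rw [this]
    nth_rewrite 1 [e1]
    rw [Matrix.mul_assoc, ← Matrix.mul_assoc S, h1, Matrix.zero_mul, Matrix.mul_zero]
  exact sub_eq_zero.1
    (Matrix.self_mul_conjTranspose_eq_zero.1 (Matrix.conjTranspose_mul_self_eq_zero.1 e2))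

theorem rho_conjTranspose (α : ℤ → Mat m) (k : ℤ) : (rho α k)ᴴ = rho α k :=
  (Matrix.nonneg_iff_posSemidef.1 (CFC.sqrt_nonneg _)).1

theorem rhoT_conjTranspose (α : ℤ → Mat m) (k : ℤ) : (rhoT α k)ᴴ = rhoT α k :=
  (Matrix.nonneg_iff_posSemidef.1 (CFC.sqrt_nonneg _)).1

theorem rho_mul_rho {k : ℤ} (hα : ‖α k‖ < 1) : rho α k * rho α k = 1 - (α k)ᴴ * α k :=
  CFC.sqrt_mul_sqrt_self _ (one_sub_conjTranspose_mul_self_nonneg hα.le)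

theorem rho_star (α : ℤ → Mat m) (k : ℤ) : rho (fun j => (α j)ᴴ) k = rhoT α k := by
  simp [rho, rhoT]

theorem rhoT_star (α : ℤ → Mat m) (k : ℤ) : rhoT (fun j => (α j)ᴴ) k = rho α k := by
  simp [rho, rhoT]

theorem norm_star_lt (hα : ∀ k, ‖α k‖ < 1) (k : ℤ) : ‖(fun j => (α j)ᴴ) k‖ < 1 :=
  (Matrix.l2_opNorm_conjTranspose (α k)).trans_lt (hα k)

theorem rhoT_mul_rhoT {k : ℤ} (hα : ‖α k‖ < 1) : rhoT α k * rhoT α k = 1 - α k * (α k)ᴴ := by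
  have := rho_mul_rho (α := fun j => (α j)ᴴ) (k := k)
    ((Matrix.l2_opNorm_conjTranspose (α k)).trans_lt hα)
  simpa only [rho_star, Matrix.conjTranspose_conjTranspose] using this

theorem rhoT_mul {k : ℤ} (hα : ‖α k‖ < 1) : rhoT α k * α k = α k * rho α k :=
  sqrt_mul_eq_mul_sqrt hα.le

theorem rho_mul_conjTranspose {k : ℤ} (hα : ‖α k‖ < 1) :
    rho α k * (α k)ᴴ = (α k)ᴴ * rhoT α k := by
  have := congrArg Matrix.conjTranspose (rhoT_mul hα)
  rw [Matrix.conjTranspose_mul, Matrix.conjTranspose_mul, rho_conjTranspose,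
    rhoT_conjTranspose] at this
  exact this.symm

theorem toEuclideanCLM_comp (A B : Mat m) (x : EuclideanSpace ℂ (Fin m)) :
    Matrix.toEuclideanCLM (𝕜 := ℂ) A (Matrix.toEuclideanCLM (𝕜 := ℂ) B x) =
      Matrix.toEuclideanCLM (𝕜 := ℂ) (A * B) x := by
  rw [map_mul]; rfl

theorem inner_toEuclideanCLM_left (A : Mat m) (x y : EuclideanSpace ℂ (Fin m)) :
    inner ℂ (Matrix.toEuclideanCLM (𝕜 := ℂ) A x) y =
      inner ℂ x (Matrix.toEuclideanCLM (𝕜 := ℂ) Aᴴ y) := by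
  have : Matrix.toEuclideanCLM (𝕜 := ℂ) Aᴴ =
      ContinuousLinearMap.adjoint (Matrix.toEuclideanCLM (𝕜 := ℂ) A) :=
    map_star (Matrix.toEuclideanCLM (𝕜 := ℂ) (n := Fin m)) A
  rw [this, ContinuousLinearMap.adjoint_inner_right]

theorem blockFun_of_pos {P : ℤ → Prop} [DecidablePred P] {n : ℤ} (h : P n)
    (φ : ℤ → EuclideanSpace ℂ (Fin m)) :
    blockFun α P φ n = Matrix.toEuclideanCLM (𝕜 := ℂ) (rho α n) (φ (n - 1)) +
      Matrix.toEuclideanCLM (𝕜 := ℂ) (α n)ᴴ (φ n) := if_pos h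

theorem blockFun_of_neg {P : ℤ → Prop} [DecidablePred P] {n : ℤ} (h : ¬P n)
    (φ : ℤ → EuclideanSpace ℂ (Fin m)) :
    blockFun α P φ n = Matrix.toEuclideanCLM (𝕜 := ℂ) (-α (n + 1)) (φ n) +
      Matrix.toEuclideanCLM (𝕜 := ℂ) (rhoT α (n + 1)) (φ (n + 1)) := if_neg h

/-- The blocks built from the adjoint coefficients invert the blocks. -/
theorem blockFun_star_blockFun (hα : ∀ k, ‖α k‖ < 1) {P : ℤ → Prop} [DecidablePred P]
    (hP : ∀ n, P (n + 1) ↔ ¬P n) (φ : ℤ → EuclideanSpace ℂ (Fin m)) (n : ℤ) :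
    blockFun (fun j => (α j)ᴴ) P (blockFun α P φ) n = φ n := by
  by_cases h : P n
  · have h' : ¬P (n - 1) := by
      have := hP (n - 1)
      rw [sub_add_cancel] at this
      exact this.1 h
    rw [blockFun_of_pos h, blockFun_of_pos h, blockFun_of_neg h', sub_add_cancel, rho_star,
      Matrix.conjTranspose_conjTranspose]
    simp only [map_add, toEuclideanCLM_comp]
    have e1 : rhoT α n * -α n = -(α n * rho α n) := by rw [mul_neg, rhoT_mul (hα n)]
    rw [e1, rhoT_mul_rhoT (hα n), map_neg, map_sub, map_one]
    simp only [neg_apply, sub_apply, one_apply_eq_self]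
    abel
  · have h' : P (n + 1) := (hP n).2 h
    rw [blockFun_of_neg h, blockFun_of_neg h, blockFun_of_pos h', add_sub_cancel_right, rhoT_star]
    simp only [map_add, toEuclideanCLM_comp]
    have e1 : -(α (n + 1))ᴴ * -α (n + 1) = (α (n + 1))ᴴ * α (n + 1) := neg_mul_neg _ _
    have e2 : -(α (n + 1))ᴴ * rhoT α (n + 1) = -(rho α (n + 1) * (α (n + 1))ᴴ) := by
      rw [neg_mul, rho_mul_conjTranspose (hα _)]
    rw [e1, e2, rho_mul_rho (hα _), map_neg, map_sub, map_one]
    simp only [neg_apply, sub_apply, one_apply_eq_self]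
    abel

/-- The block `Θₖ` is an isometry: the diagonal terms add up by the formulas for `ρₖ²` and `ρ̃ₖ²`,
and the cross terms cancel because `ρₖ αₖ* = αₖ* ρ̃ₖ`. -/
theorem norm_sq_block {k : ℤ} (hα : ‖α k‖ < 1) (x y : EuclideanSpace ℂ (Fin m)) :
    ‖Matrix.toEuclideanCLM (𝕜 := ℂ) (rho α k) x + Matrix.toEuclideanCLM (𝕜 := ℂ) (α k)ᴴ y‖ ^ 2 +
      ‖Matrix.toEuclideanCLM (𝕜 := ℂ) (-α k) x + Matrix.toEuclideanCLM (𝕜 := ℂ) (rhoT α k) y‖ ^ 2 =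
      ‖y‖ ^ 2 + ‖x‖ ^ 2 := by
  have h : ∀ v : EuclideanSpace ℂ (Fin m), ((‖v‖ ^ 2 : ℝ) : ℂ) = inner ℂ v v := fun v => by
    rw [inner_self_eq_norm_sq_to_K]; push_cast; rfl
  have : (((‖Matrix.toEuclideanCLM (𝕜 := ℂ) (rho α k) x +
      Matrix.toEuclideanCLM (𝕜 := ℂ) (α k)ᴴ y‖ ^ 2 +
      ‖Matrix.toEuclideanCLM (𝕜 := ℂ) (-α k) x +
        Matrix.toEuclideanCLM (𝕜 := ℂ) (rhoT α k) y‖ ^ 2 : ℝ)) : ℂ) =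
      ((‖y‖ ^ 2 + ‖x‖ ^ 2 : ℝ) : ℂ) := by
    rw [Complex.ofReal_add, Complex.ofReal_add, h, h, h, h]
    simp only [inner_add_left, inner_add_right, inner_toEuclideanCLM_left, toEuclideanCLM_comp,
      rho_conjTranspose, rhoT_conjTranspose, Matrix.conjTranspose_conjTranspose,
      rho_mul_rho hα, rhoT_mul_rhoT hα,
      rhoT_mul hα, rho_mul_conjTranspose hα, map_neg, map_sub, map_one,
      neg_apply, sub_apply, inner_neg_right, inner_neg_left, inner_sub_right, one_apply_eq_self]
    ring
  exact_mod_cast this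

theorem blockOp_apply (hα : ∀ k, ‖α k‖ < 1) (P : ℤ → Prop) [DecidablePred P] (φ : Ell2 m) (n : ℤ) :
    blockOp α hα P φ n = blockFun α P φ n := rfl

/-- The pairs `{n - 1, n}` with `P n` partition the integers. This sums the local isometries
`norm_sq_block` to a global one. -/
theorem tsum_eq_zero_of_pairs {P : ℤ → Prop} (hP : ∀ n, P (n + 1) ↔ ¬P n) {g : ℤ → ℝ}
    (hg : Summable g) (h : ∀ n, P n → g n + g (n - 1) = 0) : ∑' n, g n = 0 := by
  let A : Set ℤ := {n | P n}
  have hps : Summable (A.indicator g) := hg.indicator _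
  have hqs : Summable (Aᶜ.indicator g) := hg.indicator _
  have hqs' : Summable fun n => Aᶜ.indicator g (n - 1) :=
    hqs.comp_injective (i := fun n : ℤ => n - 1) (sub_left_injective)
  have h1 : ∑' n, g n = ∑' n, A.indicator g n + ∑' n, Aᶜ.indicator g n := by
    rw [← hps.tsum_add hqs]
    exact tsum_congr fun n => (congrFun (Set.indicator_self_add_compl A g) n).symm
  have h2 : ∑' n, Aᶜ.indicator g n = ∑' n, Aᶜ.indicator g (n - 1) := by
    have := (Equiv.subRight (1 : ℤ)).tsum_eq (Aᶜ.indicator g)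
    simp only [Equiv.subRight_apply] at this
    exact this.symm
  have h3 : ∀ n, A.indicator g n + Aᶜ.indicator g (n - 1) = 0 := by
    intro n
    have hn := hP (n - 1)
    rw [sub_add_cancel] at hn
    by_cases hPn : P n
    · have e1 : n ∈ A := hPn
      have e2 : n - 1 ∈ Aᶜ := hn.1 hPn
      rw [Set.indicator_of_mem e1, Set.indicator_of_mem e2, h n hPn]
    · have e1 : n ∉ A := hPn
      have e2 : n - 1 ∉ Aᶜ := fun h => hPn (hn.2 h)
      rw [Set.indicator_of_notMem e1, Set.indicator_of_notMem e2, add_zero]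
  rw [h1, h2, ← hps.tsum_add hqs', tsum_congr h3, tsum_zero]

theorem norm_blockOp (hα : ∀ k, ‖α k‖ < 1) {P : ℤ → Prop} [DecidablePred P]
    (hP : ∀ n, P (n + 1) ↔ ¬P n) (φ : Ell2 m) : ‖blockOp α hα P φ‖ = ‖φ‖ := by
  have h1 := lp.hasSum_norm (p := 2) (by norm_num) (blockOp α hα P φ)
  have h2 := lp.hasSum_norm (p := 2) (by norm_num) φ
  simp only [ENNReal.toReal_ofNat, Real.rpow_two] at h1 h2
  have h3 := h1.sub h2
  have h4 := tsum_eq_zero_of_pairs hP h3.summable fun n hn => by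
    have h' : ¬P (n - 1) := by
      have := hP (n - 1)
      rw [sub_add_cancel] at this
      exact this.1 hn
    simp only [blockOp_apply]
    rw [blockFun_of_pos hn, blockFun_of_neg h', sub_add_cancel]
    linarith [norm_sq_block (hα n) (φ (n - 1)) (φ n)]
  rw [h3.tsum_eq, sub_eq_zero] at h4
  exact (pow_left_inj₀ (norm_nonneg _) (norm_nonneg _) two_ne_zero).1 h4

theorem even_succ_iff (n : ℤ) : Even (n + 1) ↔ ¬Even n := Int.even_add_one

theorem odd_succ_iff (n : ℤ) : Odd (n + 1) ↔ ¬Odd n := by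
  rw [← Int.not_even_iff_odd, ← Int.not_even_iff_odd, Int.even_add_one]

theorem blockOp_star_mul (hα : ∀ k, ‖α k‖ < 1) {P : ℤ → Prop} [DecidablePred P]
    (hP : ∀ n, P (n + 1) ↔ ¬P n) :
    blockOp (fun j => (α j)ᴴ) (norm_star_lt hα) P * blockOp α hα P = 1 := by
  ext1 φ
  ext1
  funext n
  exact blockFun_star_blockFun hα hP φ n

theorem blockOp_mul_star (hα : ∀ k, ‖α k‖ < 1) {P : ℤ → Prop} [DecidablePred P]
    (hP : ∀ n, P (n + 1) ↔ ¬P n) :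
    blockOp α hα P * blockOp (fun j => (α j)ᴴ) (norm_star_lt hα) P = 1 := by
  have := blockOp_star_mul (norm_star_lt hα) hP
  simpa only [Matrix.conjTranspose_conjTranspose] using this

/-- The inverse of the CMV operator. -/
def opUinv (α : ℤ → Mat m) (hα : ∀ k, ‖α k‖ < 1) : Ell2 m →L[ℂ] Ell2 m :=
  blockOp (fun j => (α j)ᴴ) (norm_star_lt hα) Odd * blockOp (fun j => (α j)ᴴ) (norm_star_lt hα) Even

theorem opU_mul_opUinv (hα : ∀ k, ‖α k‖ < 1) : opU α hα * opUinv α hα = 1 := by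
  rw [opU, opUinv, opV, opW, mul_assoc, ← mul_assoc (blockOp α hα Odd),
    blockOp_mul_star hα odd_succ_iff, one_mul, blockOp_mul_star hα even_succ_iff]

theorem opUinv_mul_opU (hα : ∀ k, ‖α k‖ < 1) : opUinv α hα * opU α hα = 1 := by
  rw [opU, opUinv, opV, opW, mul_assoc, ← mul_assoc (blockOp _ _ Even) _ (blockOp α hα Odd),
    blockOp_star_mul hα even_succ_iff, one_mul, blockOp_star_mul hα odd_succ_iff]

theorem norm_opU_apply (hα : ∀ k, ‖α k‖ < 1) (φ : Ell2 m) : ‖opU α hα φ‖ = ‖φ‖ :=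
  (norm_blockOp hα even_succ_iff _).trans (norm_blockOp hα odd_succ_iff φ)

theorem norm_opUinv_le (hα : ∀ k, ‖α k‖ < 1) : ‖opUinv α hα‖ ≤ 1 := by
  refine ContinuousLinearMap.opNorm_le_bound _ zero_le_one fun φ => ?_
  have := norm_opU_apply hα (opUinv α hα φ)
  have e : opU α hα (opUinv α hα φ) = φ := congrArg (fun T => T φ) (opU_mul_opUinv hα)
  rw [e] at this
  rw [one_mul, this]

theorem opUinv_apply (hα : ∀ k, ‖α k‖ < 1) (φ : Ell2 m) (n : ℤ) : opUinv α hα φ n =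
    blockFun (fun j => (α j)ᴴ) Odd (blockFun (fun j => (α j)ᴴ) Even φ) n := rfl

theorem opUinv_apply_odd (hα : ∀ k, ‖α k‖ < 1) {n : ℤ} (hn : Odd n) (φ : Ell2 m) :
    opUinv α hα φ n =
      Matrix.toEuclideanCLM (𝕜 := ℂ) (rhoT α n) (
        Matrix.toEuclideanCLM (𝕜 := ℂ) (rhoT α (n - 1)) (φ (n - 2)) +
        Matrix.toEuclideanCLM (𝕜 := ℂ) (α (n - 1)) (φ (n - 1))) +
      Matrix.toEuclideanCLM (𝕜 := ℂ) (α n) (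
        Matrix.toEuclideanCLM (𝕜 := ℂ) (-(α (n + 1))ᴴ) (φ n) +
        Matrix.toEuclideanCLM (𝕜 := ℂ) (rho α (n + 1)) (φ (n + 1))) := by
  have h1 : Even (n - 1) := hn.sub_odd odd_one
  have h2 : ¬Even n := Int.not_even_iff_odd.2 hn
  rw [opUinv_apply, blockFun_of_pos hn, blockFun_of_pos h1, blockFun_of_neg h2, rho_star,
    rho_star, rhoT_star,
    Matrix.conjTranspose_conjTranspose, Matrix.conjTranspose_conjTranspose,
    show n - 1 - 1 = n - 2 by ring]

theorem opUinv_apply_even (hα : ∀ k, ‖α k‖ < 1) {n : ℤ} (hn : Even n) (φ : Ell2 m) :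
    opUinv α hα φ n =
      Matrix.toEuclideanCLM (𝕜 := ℂ) (-(α (n + 1))ᴴ) (
        Matrix.toEuclideanCLM (𝕜 := ℂ) (rhoT α n) (φ (n - 1)) +
        Matrix.toEuclideanCLM (𝕜 := ℂ) (α n) (φ n)) +
      Matrix.toEuclideanCLM (𝕜 := ℂ) (rho α (n + 1)) (
        Matrix.toEuclideanCLM (𝕜 := ℂ) (-(α (n + 2))ᴴ) (φ (n + 1)) +
        Matrix.toEuclideanCLM (𝕜 := ℂ) (rho α (n + 2)) (φ (n + 2))) := by
  have h1 : ¬Even (n + 1) := Int.not_even_iff_odd.2 hn.add_one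
  have h2 : ¬Odd n := Int.not_odd_iff_even.2 hn
  rw [opUinv_apply, blockFun_of_neg h2, blockFun_of_pos hn, blockFun_of_neg h1, rho_star,
    rhoT_star, rhoT_star,
    Matrix.conjTranspose_conjTranspose, show n + 1 + 1 = n + 2 by ring]

/-! ### Compression to a site: expansion and positivity of `M11` -/

/-- The compression of an operator to the site `k`, as a continuous linear map into matrices. -/
def compress (k : ℤ) : (Ell2 m →L[ℂ] Ell2 m) →L[ℂ] Mat m :=
  ∑ i, ∑ j, (((EuclideanSpace.proj i : EuclideanSpace ℂ (Fin m) →L[ℂ] ℂ) ∘L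
    lp.evalCLM ℂ (fun _ : ℤ => EuclideanSpace ℂ (Fin m)) 2 k) ∘L
    ContinuousLinearMap.apply ℂ (Ell2 m)
      (lp.single 2 k (EuclideanSpace.single j (1 : ℂ)))).smulRight (Matrix.single i j (1 : ℂ))

theorem compress_apply (k : ℤ) (T : Ell2 m →L[ℂ] Ell2 m) :
    compress k T = Matrix.of fun i j => T (lp.single 2 k (EuclideanSpace.single j (1 : ℂ))) k i := by
  conv_rhs => rw [Matrix.matrix_eq_sum_single
    (Matrix.of fun i j => T (lp.single 2 k (EuclideanSpace.single j (1 : ℂ))) k i)]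
  simp [compress]
  rfl

theorem toEuclideanCLM_compress (k : ℤ) (T : Ell2 m →L[ℂ] Ell2 m) (x : EuclideanSpace ℂ (Fin m)) :
    Matrix.toEuclideanCLM (𝕜 := ℂ) (compress k T) x = T (lp.single 2 k x) k := by
  have h : (Matrix.toEuclideanCLM (𝕜 := ℂ) (compress k T)).toLinearMap =
      ((lp.evalCLM ℂ (fun _ : ℤ => EuclideanSpace ℂ (Fin m)) 2 k ∘L T) ∘L
        lp.singleContinuousLinearMap ℂ (fun _ : ℤ => EuclideanSpace ℂ (Fin m)) 2 k).toLinearMap := by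
    refine (EuclideanSpace.basisFun (Fin m) ℂ).toBasis.ext fun j => ?_
    ext i
    simp [compress_apply]
    rfl
  exact congrArg (fun f => f x) h

theorem compress_eq {k : ℤ} {T : Ell2 m →L[ℂ] Ell2 m} {B : Mat m}
    (h : ∀ x, T (lp.single 2 k x) k = Matrix.toEuclideanCLM (𝕜 := ℂ) B x) : compress k T = B := by
  refine (Matrix.toEuclideanCLM (𝕜 := ℂ) (n := Fin m)).injective ?_
  ext1 x
  exact (toEuclideanCLM_compress k T x).trans (h x)

theorem M11_eq_compress (hα : ∀ k, ‖α k‖ < 1) (k : ℤ) (z : ℂ) : M11 α hα k z =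
    compress k ((opU α hα + z • 1) * Ring.inverse (opU α hα - z • 1)) :=
  (compress_apply k _).symm

theorem isUnit_opU (hα : ∀ k, ‖α k‖ < 1) : IsUnit (opU α hα) :=
  ⟨⟨opU α hα, opUinv α hα, opU_mul_opUinv hα, opUinv_mul_opU hα⟩, rfl⟩

theorem isUnit_one_sub_smul_opUinv (hα : ∀ k, ‖α k‖ < 1) {z : ℂ} (hz : ‖z‖ < 1) :
    IsUnit (1 - z • opUinv α hα) := by
  refine isUnit_one_sub_of_norm_lt_one ?_
  rw [norm_smul]
  exact (mul_le_of_le_one_right (norm_nonneg z) (norm_opUinv_le hα)).trans_lt hz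

theorem opU_sub_eq (hα : ∀ k, ‖α k‖ < 1) (z : ℂ) :
    opU α hα - z • 1 = opU α hα * (1 - z • opUinv α hα) := by
  rw [mul_sub, mul_one, mul_smul_comm, opU_mul_opUinv]

theorem isUnit_opU_sub (hα : ∀ k, ‖α k‖ < 1) {z : ℂ} (hz : ‖z‖ < 1) :
    IsUnit (opU α hα - z • 1) := by
  rw [opU_sub_eq]
  exact (isUnit_opU hα).mul (isUnit_one_sub_smul_opUinv hα hz)

theorem differentiableOn_M11 (hα : ∀ k, ‖α k‖ < 1) (k : ℤ) :
    DifferentiableOn ℂ (M11 α hα k) (Metric.ball 0 1) := by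
  intro z hz
  rw [mem_ball_zero_iff] at hz
  have h1 : DifferentiableAt ℂ (fun z : ℂ => opU α hα - z • (1 : Ell2 m →L[ℂ] Ell2 m)) z := by
    fun_prop
  have h2 : DifferentiableAt ℂ (fun z : ℂ => opU α hα + z • (1 : Ell2 m →L[ℂ] Ell2 m)) z := by
    fun_prop
  obtain ⟨u, hu⟩ := isUnit_opU_sub hα hz
  have h3 : DifferentiableAt ℂ Ring.inverse (opU α hα - z • (1 : Ell2 m →L[ℂ] Ell2 m)) := by
    rw [← hu]
    exact differentiableAt_inverse (𝕜 := ℂ) u.isUnit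
  have h4 := ((compress k).differentiableAt.comp z (h2.mul (h3.comp z h1)))
  refine DifferentiableAt.differentiableWithinAt ?_
  refine h4.congr_of_eventuallyEq (Eventually.of_forall fun w => ?_)
  exact M11_eq_compress hα k w

/-- The expansion of `M₁,₁` at `0` to second order. -/
theorem exists_M11_expansion (hα : ∀ k, ‖α k‖ < 1) (k : ℤ) :
    ∃ R : ℂ → Mat m, ContinuousAt R 0 ∧ ∀ z ∈ Metric.ball (0 : ℂ) 1,
      M11 α hα k z = 1 + (2 * z) • compress k (opUinv α hα) +
        (2 * z ^ 2) • compress k (opUinv α hα * opUinv α hα) + z ^ 3 • R z := by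
  set V := opUinv α hα with hV
  -- With `V = U⁻¹`, `(U + z)(U - z)⁻¹ = 1 + 2zV(1 - zV)⁻¹`. The remainder comes from expanding the
  -- resolvent two steps further.
  refine ⟨fun z => compress k ((2 : ℂ) • (V * V * V * Ring.inverse (1 - z • V))), ?_, ?_⟩
  · have h1 : ContinuousAt (fun z : ℂ => 1 - z • V) 0 := by fun_prop
    have h2 : ContinuousAt Ring.inverse ((fun z : ℂ => 1 - z • V) 0) := by
      have : (fun z : ℂ => 1 - z • V) 0 = ((1 : (Ell2 m →L[ℂ] Ell2 m)ˣ) : Ell2 m →L[ℂ] Ell2 m) := by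
        simp
      rw [this]
      exact NormedRing.inverse_continuousAt 1
    have h3 : ContinuousAt (fun z : ℂ => Ring.inverse (1 - z • V)) 0 :=
      ContinuousAt.comp (f := fun z : ℂ => 1 - z • V) h2 h1
    exact (compress k).continuous.continuousAt.comp ((continuousAt_const.mul h3).const_smul (2 : ℂ))
  · intro z hz
    rw [mem_ball_zero_iff] at hz
    have hu := isUnit_one_sub_smul_opUinv hα hz
    have hW : (1 - z • V) * Ring.inverse (1 - z • V) = 1 := Ring.mul_inverse_cancel _ hu
    set W := Ring.inverse (1 - z • V) with hWdef
    have e0 : opU α hα + z • 1 = opU α hα * (1 + z • V) := by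
      rw [mul_add, mul_one, mul_smul_comm, opU_mul_opUinv]
    have hW' : W * (1 - z • V) = 1 := Ring.inverse_mul_cancel _ hu
    have hVW : V * W = W * V := by
      have hc : (1 - z • V) * V = V * (1 - z • V) := by
        rw [sub_mul, mul_sub, one_mul, mul_one, smul_mul_assoc, mul_smul_comm]
      calc V * W = W * (1 - z • V) * V * W := by rw [hW', one_mul]
        _ = W * V := by rw [mul_assoc W, hc, mul_assoc, mul_assoc V, hW, mul_one]
    have e2 : Ring.inverse (opU α hα - z • 1) = W * V := by
      have h1 : (opU α hα - z • 1) * (W * V) = 1 := by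
        rw [opU_sub_eq, mul_assoc, ← mul_assoc _ W V, hW, one_mul, opU_mul_opUinv]
      calc Ring.inverse (opU α hα - z • 1)
          = Ring.inverse (opU α hα - z • 1) * ((opU α hα - z • 1) * (W * V)) := by rw [h1, mul_one]
        _ = W * V := by
          rw [← mul_assoc, Ring.inverse_mul_cancel _ (isUnit_opU_sub hα hz), one_mul]
    have hW1 : W = 1 + z • (V * W) := by
      rw [sub_mul, one_mul, smul_mul_assoc, sub_eq_iff_eq_add] at hW
      exact hW
    have e3 : (opU α hα + z • 1) * Ring.inverse (opU α hα - z • 1) = 1 + (2 : ℂ) • z • (V * W) := by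
      rw [e2, ← hVW, add_mul, ← mul_assoc, opU_mul_opUinv, one_mul, smul_mul_assoc, one_mul]
      nth_rewrite 1 [hW1]
      module
    have e4 : V * W = V + z • (V * V) + z ^ 2 • (V * V * V * W) := by
      have h1 : V * W = V + z • (V * V * W) := by
        conv_lhs => rw [hW1]
        rw [mul_add, mul_one, mul_smul_comm, mul_assoc]
      have h2 : V * V * W = V * V + z • (V * V * V * W) := by
        conv_lhs => rw [mul_assoc, h1]
        rw [mul_add, mul_smul_comm]
        simp only [mul_assoc]
      rw [h1, h2]
      module
    have hone : compress k (1 : Ell2 m →L[ℂ] Ell2 m) = 1 := by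
      refine compress_eq fun x => ?_
      simp
    rw [M11_eq_compress, e3, e4]
    simp only [map_add, map_smul, hone]
    module

theorem inner_single_left (k : ℤ) (x : EuclideanSpace ℂ (Fin m)) (φ : Ell2 m) :
    inner ℂ (lp.single 2 k x : Ell2 m) φ = inner ℂ x (φ k) := by
  exact lp.inner_single_left (𝕜 := ℂ) (G := fun _ : ℤ => EuclideanSpace ℂ (Fin m)) k x φ

/-- `M₁,₁` has positive real part in the disk. -/
theorem re_inner_M11_pos (hα : ∀ k, ‖α k‖ < 1) (k : ℤ) {z : ℂ} (hz : ‖z‖ < 1)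
    {x : EuclideanSpace ℂ (Fin m)} (hx : x ≠ 0) :
    0 < (inner ℂ x (Matrix.toEuclideanCLM (𝕜 := ℂ) (M11 α hα k z) x)).re := by
  rw [M11_eq_compress, toEuclideanCLM_compress, ← inner_single_left]
  have hu := isUnit_opU_sub hα hz
  set φ : Ell2 m := lp.single 2 k x with hφ
  have hφ0 : φ ≠ 0 := by
    intro h
    apply hx
    have := congrArg (fun ψ : Ell2 m => ψ k) h
    simpa [hφ] using this
  set ψ : Ell2 m := Ring.inverse (opU α hα - z • 1) φ with hψ
  have e1 : opU α hα ψ - z • ψ = φ := by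
    have := congrArg (fun T : Ell2 m →L[ℂ] Ell2 m => T φ) (Ring.mul_inverse_cancel _ hu)
    exact this
  have e2 : ((opU α hα + z • 1) * Ring.inverse (opU α hα - z • 1)) φ = opU α hα ψ + z • ψ := rfl
  have hψ0 : ψ ≠ 0 := by
    intro h
    rw [h] at e1
    apply hφ0
    rw [← e1]; simp
  have hn := norm_opU_apply hα ψ
  rw [e2, ← e1]
  -- The two cross terms are conjugate to each other with opposite signs, so their sum is purely
  -- imaginary.
  have h3 : (inner ℂ (opU α hα ψ - z • ψ) (opU α hα ψ + z • ψ)).re =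
      ‖opU α hα ψ‖ ^ 2 - ‖z • ψ‖ ^ 2 := by
    rw [inner_sub_left, inner_add_right, inner_add_right, ← inner_conj_symm (z • ψ) (opU α hα ψ)]
    have a1 : (inner ℂ (opU α hα ψ) (opU α hα ψ)).re = ‖opU α hα ψ‖ ^ 2 :=
      inner_self_eq_norm_sq (𝕜 := ℂ) _
    have a2 : (inner ℂ (z • ψ) (z • ψ)).re = ‖z • ψ‖ ^ 2 := inner_self_eq_norm_sq (𝕜 := ℂ) _
    simp only [Complex.sub_re, Complex.add_re, Complex.conj_re, a1, a2]
    ring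
  rw [h3, hn, norm_smul, mul_pow]
  have h4 : 0 < ‖ψ‖ ^ 2 := by positivity
  have h5 : ‖z‖ ^ 2 < 1 := by nlinarith [norm_nonneg z]
  nlinarith

theorem lp_single_apply_ne {k n : ℤ} (h : n ≠ k) (x : EuclideanSpace ℂ (Fin m)) :
    (lp.single 2 k x : Ell2 m) n = 0 :=
  lp.single_apply_ne (E := fun _ : ℤ => EuclideanSpace ℂ (Fin m)) 2 k x h

theorem compress_opUinv_odd (hα : ∀ k, ‖α k‖ < 1) {k : ℤ} (hk : Odd k) :
    compress k (opUinv α hα) = -(α k * (α (k + 1))ᴴ) := by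
  refine compress_eq fun x => ?_
  rw [opUinv_apply_odd hα hk, lp.single_apply_self, lp_single_apply_ne (by omega),
    lp_single_apply_ne (by omega), lp_single_apply_ne (by omega)]
  simp only [map_zero, zero_add, add_zero, toEuclideanCLM_comp, mul_neg]

theorem compress_opUinv_even (hα : ∀ k, ‖α k‖ < 1) {k : ℤ} (hk : Even k) :
    compress k (opUinv α hα) = -((α (k + 1))ᴴ * α k) := by
  refine compress_eq fun x => ?_
  rw [opUinv_apply_even hα hk, lp.single_apply_self, lp_single_apply_ne (by omega),
    lp_single_apply_ne (by omega), lp_single_apply_ne (by omega)]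
  simp only [map_zero, zero_add, add_zero, toEuclideanCLM_comp, neg_mul]

/-- In `V²` a path from `k` back to `k` passes through one intermediate site. An odd row `n` of `V`
reaches only `n - 2, …, n + 1` and an even row only `n - 1, …, n + 2`, so the intermediate site is
`k` itself, which gives the square of the compression, or `k ± 1`, which gives the two terms in the
bracket. -/
theorem compress_opUinv_sq_odd (hα : ∀ k, ‖α k‖ < 1) {k : ℤ} (hk : Odd k) :
    compress k (opUinv α hα * opUinv α hα) =
      compress k (opUinv α hα) * compress k (opUinv α hα) -
      (α k * rho α (k + 1) * (α (k + 2))ᴴ * rhoT α (k + 1) +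
        rhoT α k * α (k - 1) * rho α k * (α (k + 1))ᴴ) := by
  rw [compress_opUinv_odd hα hk]
  refine compress_eq fun x => ?_
  change opUinv α hα (opUinv α hα (lp.single 2 k x)) k = _
  have h1 : Even (k - 1) := hk.sub_odd odd_one
  have h2 : Even (k + 1) := hk.add_one
  have h3 : Odd (k - 2) := hk.sub_even even_two
  have hz : ∀ n, n ≠ k → (lp.single 2 k x : Ell2 m) n = 0 := fun n hn => lp_single_apply_ne hn x
  rw [opUinv_apply_odd hα hk, opUinv_apply_odd hα hk, opUinv_apply_odd hα h3,
    opUinv_apply_even hα h1, opUinv_apply_even hα h2]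
  simp only [sub_add_cancel, add_sub_cancel_right, show k + 1 + 1 = k + 2 by ring,
    show k - 1 + 2 = k + 1 by ring, lp.single_apply_self, hz (k - 2 - 2) (by omega),
    hz (k - 2 - 1) (by omega),
    hz (k - 2) (by omega), hz (k - 2 + 1) (by omega), hz (k - 1 - 1) (by omega),
    hz (k - 1) (by omega), hz (k + 1) (by omega),
    hz (k + 2) (by omega), hz (k + 1 + 2) (by omega)]
  simp only [map_zero, zero_add, add_zero, map_add, toEuclideanCLM_comp, map_neg, neg_apply,
    map_sub, sub_apply, mul_neg, neg_mul, neg_neg, add_apply, Matrix.mul_assoc]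
  abel

theorem compress_opUinv_sq_even (hα : ∀ k, ‖α k‖ < 1) {k : ℤ} (hk : Even k) :
    compress k (opUinv α hα * opUinv α hα) =
      compress k (opUinv α hα) * compress k (opUinv α hα) -
      (rho α (k + 1) * (α (k + 2))ᴴ * rhoT α (k + 1) * α k +
        (α (k + 1))ᴴ * rhoT α k * α (k - 1) * rho α k) := by
  rw [compress_opUinv_even hα hk]
  refine compress_eq fun x => ?_
  change opUinv α hα (opUinv α hα (lp.single 2 k x)) k = _
  have h1 : Odd (k - 1) := hk.sub_odd odd_one
  have h2 : Odd (k + 1) := hk.add_one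
  have h3 : Even (k + 2) := hk.add even_two
  have hz : ∀ n, n ≠ k → (lp.single 2 k x : Ell2 m) n = 0 := fun n hn => lp_single_apply_ne hn x
  rw [opUinv_apply_even hα hk, opUinv_apply_even hα hk, opUinv_apply_even hα h3,
    opUinv_apply_odd hα h1, opUinv_apply_odd hα h2]
  simp only [sub_add_cancel, add_sub_cancel_right, show k + 1 + 1 = k + 2 by ring,
    lp.single_apply_self, hz (k - 1 - 2) (by omega), hz (k - 1 - 1) (by omega),
    hz (k - 1) (by omega), hz (k + 1 - 2) (by omega), hz (k + 1) (by omega),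
    hz (k + 2) (by omega), hz (k + 2 + 1) (by omega),
    hz (k + 2 + 2) (by omega), hz (k + 2 - 1) (by omega)]
  simp only [map_zero, zero_add, add_zero, map_add, toEuclideanCLM_comp, map_neg, neg_apply,
    map_sub, sub_apply, mul_neg, neg_mul, neg_neg, add_apply, Matrix.mul_assoc]
  abel

/-! ### Accretive matrices and the derivative of the matrix logarithm -/

/-- A matrix with positive definite real part. -/
def Accretive (A : Mat m) : Prop :=
  ∀ x : EuclideanSpace ℂ (Fin m), x ≠ 0 → 0 < (inner ℂ x (Matrix.toEuclideanCLM (𝕜 := ℂ) A x)).re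

/-- The segment from `1` to `A` consists of invertible matrices. -/
def LogDomain (A : Mat m) : Prop := ∀ t ∈ Set.Icc (0 : ℝ) 1, IsUnit (1 + (t : ℂ) • (A - 1))

theorem Accretive.isUnit {A : Mat m} (hA : Accretive A) : IsUnit A := by
  rw [← Matrix.mulVec_injective_iff_isUnit]
  refine (injective_iff_map_eq_zero (Matrix.mulVecLin A)).2 fun v hv => ?_
  by_contra h
  have h2 := hA (WithLp.toLp 2 v) (by simpa using h)
  rw [Matrix.toEuclideanCLM_toLp] at h2
  have h3 : A *ᵥ v = 0 := hv
  rw [h3] at h2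
  simp at h2

theorem re_inner_self_pos {x : EuclideanSpace ℂ (Fin m)} (hx : x ≠ 0) :
    0 < (inner ℂ x x).re := by
  have : (inner ℂ x x).re = ‖x‖ ^ 2 := inner_self_eq_norm_sq (𝕜 := ℂ) _
  rw [this]; positivity

/-- Substitute `x = A y`: the form of the inverse at `x` is the conjugate of the form of `A` at `y`.
-/
theorem re_inner_inv_nonneg {A : Mat m} (hA : Accretive A) (x : EuclideanSpace ℂ (Fin m)) :
    0 ≤ (inner ℂ x (Matrix.toEuclideanCLM (𝕜 := ℂ) A⁻¹ x)).re := by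
  set y := Matrix.toEuclideanCLM (𝕜 := ℂ) A⁻¹ x with hy
  have hx : x = Matrix.toEuclideanCLM (𝕜 := ℂ) A y := by
    rw [hy, toEuclideanCLM_comp, Matrix.mul_nonsing_inv _
      ((Matrix.isUnit_iff_isUnit_det _).1 hA.isUnit), map_one, one_apply_eq_self]
  rw [hx]
  by_cases h : y = 0
  · simp [h]
  · rw [← inner_conj_symm, Complex.conj_re]
    exact (hA y h).le

/-- `a + b A + c w` is accretive for an accretive `A`, a purely imaginary number `w` and
`a, b ≥ 0` that are not both `0`. -/
theorem accretive_combination {A : Mat m} (hA : Accretive A) {w : ℂ} (hw : w.re = 0) {a b c : ℝ}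
    (ha : 0 ≤ a) (hb : 0 ≤ b) (hab : 0 < a + b) :
    Accretive ((a : ℂ) • (1 : Mat m) + (b : ℂ) • A + (c : ℂ) • (w • (1 : Mat m))) := by
  intro x hx
  simp only [map_add, map_smul, map_one, add_apply, smul_apply, one_apply_eq_self,
    inner_add_right, inner_smul_right, Complex.add_re, Complex.re_ofReal_mul]
  have h1 := re_inner_self_pos hx
  have h2 := hA x hx
  have h3 : (w * inner ℂ x x).re = 0 := by
    have : (inner ℂ x x).im = 0 := inner_self_im (𝕜 := ℂ) x
    rw [Complex.mul_re, hw, this]; simp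
  rw [h3, mul_zero, add_zero]
  rcases ha.lt_or_eq with h | h
  · have := mul_pos h h1
    have := mul_nonneg hb h2.le
    linarith
  · have hb' : 0 < b := by linarith
    have := mul_pos hb' h2
    have := mul_nonneg ha h1.le
    linarith

/-- The matrix to invert is `(1 - t) + t(1 - τ) A + tτ w`. It is accretive unless `t = τ = 1`, where
it is the nonzero scalar `w`. -/
theorem logDomain_path {A : Mat m} (hA : Accretive A) {w : ℂ} (hw : w.re = 0) (hw0 : w ≠ 0)
    {τ : ℝ} (hτ : τ ∈ Set.Icc (0 : ℝ) 1) :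
    LogDomain (((1 - τ : ℝ) : ℂ) • A + (τ : ℂ) • (w • (1 : Mat m))) := by
  intro t ht
  have e : 1 + (t : ℂ) • (((1 - τ : ℝ) : ℂ) • A + (τ : ℂ) • (w • (1 : Mat m)) - 1) =
      ((1 - t : ℝ) : ℂ) • (1 : Mat m) + ((t * (1 - τ) : ℝ) : ℂ) • A +
        ((t * τ : ℝ) : ℂ) • (w • (1 : Mat m)) := by
    push_cast
    module
  rw [e]
  by_cases h : 0 < (1 - t) + t * (1 - τ)
  · exact (accretive_combination hA hw (by linarith [ht.2])
      (mul_nonneg ht.1 (by linarith [hτ.2])) h).isUnit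
  · have h1 : 0 ≤ t * (1 - τ) := mul_nonneg ht.1 (by linarith [hτ.2])
    have ht1 : t = 1 := by linarith [ht.2]
    have hτ1 : τ = 1 := by rw [ht1] at h; linarith [hτ.2]
    rw [ht1, hτ1]
    simp only [sub_self, mul_zero, mul_one, Complex.ofReal_zero, zero_smul, Complex.ofReal_one,
      one_smul, zero_add]
    exact ⟨⟨w • 1, w⁻¹ • 1, by simp [smul_smul, hw0], by simp [smul_smul, hw0]⟩, rfl⟩

theorem Accretive.logDomain {A : Mat m} (hA : Accretive A) : LogDomain A := by
  have := logDomain_path hA (w := Complex.I) (by simp) Complex.I_ne_zero (τ := 0) (by simp)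
  simpa using this

/-- The derivative of `(A - 1)(1 + t (A - 1))⁻¹` with respect to `A`. -/
def logKer (A : Mat m) (t : ℝ) : Mat m →L[ℂ] Mat m :=
  ContinuousLinearMap.mulLeftRight ℂ (Mat m) (1 + (t : ℂ) • (A - 1))⁻¹ (1 + (t : ℂ) • (A - 1))⁻¹

theorem logKer_apply (A : Mat m) (t : ℝ) (H : Mat m) : logKer A t H =
    (1 + (t : ℂ) • (A - 1))⁻¹ * H * (1 + (t : ℂ) • (A - 1))⁻¹ := by
  simp [logKer]

theorem continuousAt_inv_of_isUnit {X : Type*} [TopologicalSpace X] {f : X → Mat m} {x : X}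
    (hf : ContinuousAt f x) (hx : IsUnit (f x)) : ContinuousAt (fun y => (f y)⁻¹) x := by
  obtain ⟨u, hu⟩ := hx
  simp only [Matrix.nonsing_inv_eq_ringInverse]
  have h := NormedRing.inverse_continuousAt u
  rw [hu] at h
  exact h.comp hf

theorem hasFDerivAt_logIntegrand {A : Mat m} {t : ℝ} (h : IsUnit (1 + (t : ℂ) • (A - 1))) :
    HasFDerivAt (fun X : Mat m => (X - 1) * (1 + (t : ℂ) • (X - 1))⁻¹) (logKer A t) A := by
  have h1 : HasFDerivAt (fun X : Mat m => 1 + (t : ℂ) • (X - 1))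
      ((t : ℂ) • ContinuousLinearMap.id ℂ (Mat m)) A :=
    (((hasFDerivAt_id A).sub_const 1).const_smul (t : ℂ)).const_add 1
  have hR := Matrix.mul_nonsing_inv _ ((Matrix.isUnit_iff_isUnit_det _).1 h)
  obtain ⟨u, hu⟩ := h
  have h2 := hasFDerivAt_ringInverse (𝕜 := ℂ) u
  rw [hu] at h2
  have h3 := h2.comp A h1
  have h4 := ((hasFDerivAt_id A).sub_const (1 : Mat m)).mul' h3
  have hinv : (1 + (t : ℂ) • (A - 1))⁻¹ = ((u⁻¹ : (Mat m)ˣ) : Mat m) := by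
    rw [← hu]; exact Matrix.coe_units_inv u |>.symm
  refine (h4.congr_fderiv ?_).congr_of_eventuallyEq (Eventually.of_forall fun X => ?_)
  · ext1 H
    rw [logKer_apply]
    simp only [add_apply, smul_apply, ContinuousLinearMap.comp_apply, neg_apply,
      ContinuousLinearMap.mulLeftRight_apply, ContinuousLinearMap.id_apply, id,
      Function.comp_apply, smul_eq_mul, MulOpposite.smul_eq_mul_unop, MulOpposite.unop_op, ← hinv,
      ← Matrix.nonsing_inv_eq_ringInverse]
    set R := (1 + (t : ℂ) • (A - 1))⁻¹ with hRdef
    -- The product rule gives `H R - t (A - 1) R H R`; this identity, multiplied by `H R`, collapses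
    -- it to `R H R`.
    have h5 : R + (t : ℂ) • ((A - 1) * R) = 1 := by
      rw [add_mul, one_mul, smul_mul_assoc] at hR
      exact hR
    have h6 := congrArg (· * (H * R)) h5
    simp only [add_mul, one_mul, smul_mul_assoc] at h6
    rw [mul_smul_comm, smul_mul_assoc, mul_neg, mul_smul_comm, ← h6]
    simp only [mul_assoc]
    module
  · simp only [Matrix.nonsing_inv_eq_ringInverse]
    rfl

theorem continuousOn_inv_segment {A : Mat m} (hA : LogDomain A) :
    ContinuousOn (fun t : ℝ => (1 + (t : ℂ) • (A - 1))⁻¹) (Set.Icc 0 1) := fun t ht =>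
  (continuousAt_inv_of_isUnit (f := fun t : ℝ => 1 + (t : ℂ) • (A - 1)) (by fun_prop)
    (hA t ht)).continuousWithinAt

/-- Compactness of `[0, 1]` makes invertibility and the bound on the inverse uniform in `t` near
`A`; this is the domination for differentiating under the integral. -/
theorem eventually_logDomain {A : Mat m} (hA : LogDomain A) :
    ∃ C : ℝ, ∀ᶠ X in 𝓝 A, ∀ t ∈ Set.Icc (0 : ℝ) 1,
      IsUnit (1 + (t : ℂ) • (X - 1)) ∧ ‖(1 + (t : ℂ) • (X - 1))⁻¹‖ < C := by
  obtain ⟨C, hC⟩ := isCompact_Icc.exists_bound_of_continuousOn (continuousOn_inv_segment hA)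
  refine ⟨C + 1, isCompact_Icc.eventually_forall_of_forall_eventually fun t ht => ?_⟩
  have hc : ContinuousAt (fun z : Mat m × ℝ => 1 + (z.2 : ℂ) • (z.1 - 1)) (A, t) := by fun_prop
  have h1 : ∀ᶠ z in 𝓝 (A, t), IsUnit (1 + (z.2 : ℂ) • (z.1 - 1)) :=
    hc.eventually (Units.isOpen.mem_nhds (hA t ht))
  have h2 := (continuousAt_inv_of_isUnit hc (hA t ht)).norm
  have h3 := h2.eventually (gt_mem_nhds (show _ < C + 1 from (hC t ht).trans_lt (lt_add_one C)))
  exact h1.and h3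

/-- The derivative of the matrix logarithm. -/
theorem hasFDerivAt_matLog {A : Mat m} (hA : LogDomain A) :
    HasFDerivAt (matLog : Mat m → Mat m) (∫ t in (0 : ℝ)..1, logKer A t) A := by
  obtain ⟨C, hC⟩ := eventually_logDomain hA
  have hcont : ∀ X : Mat m, LogDomain X →
      ContinuousOn (fun t : ℝ => (X - 1) * (1 + (t : ℂ) • (X - 1))⁻¹) (Set.Icc 0 1) :=
    fun X hX => continuousOn_const.mul (continuousOn_inv_segment hX)
  have huIoc : Set.uIoc (0 : ℝ) 1 = Set.Ioc 0 1 := Set.uIoc_of_le zero_le_one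
  refine intervalIntegral.hasFDerivAt_integral_of_dominated_of_fderiv_le (μ := volume)
    (F := fun (X : Mat m) (t : ℝ) => (X - 1) * (1 + (t : ℂ) • (X - 1))⁻¹)
    (F' := fun X t => logKer X t) (bound := fun _ => C * C) hC ?_ ?_ ?_ ?_ ?_ ?_
  · filter_upwards [hC] with X hX
    rw [huIoc]
    exact ((hcont X fun t ht => (hX t ht).1).mono Set.Ioc_subset_Icc_self).aestronglyMeasurable
      measurableSet_Ioc
  · refine ContinuousOn.intervalIntegrable ?_
    rw [Set.uIcc_of_le zero_le_one]
    exact hcont A hA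
  · rw [huIoc]
    have h1 := (continuousOn_inv_segment hA)
    have h2 : ContinuousOn (fun t : ℝ => logKer A t) (Set.Icc 0 1) := by
      unfold logKer
      exact ((ContinuousLinearMap.mulLeftRight ℂ (Mat m)).continuous.comp_continuousOn h1).clm_apply
        h1
    exact (h2.mono Set.Ioc_subset_Icc_self).aestronglyMeasurable measurableSet_Ioc
  · refine Eventually.of_forall fun t ht X hX => ?_
    rw [huIoc] at ht
    have h := (hX t ⟨ht.1.le, ht.2⟩).2
    refine (ContinuousLinearMap.opNorm_mulLeftRight_apply_apply_le ℂ (Mat m) _ _).trans ?_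
    exact mul_le_mul h.le h.le (norm_nonneg _) ((norm_nonneg _).trans h.le)
  · exact intervalIntegrable_const
  · refine Eventually.of_forall fun t ht X hX => ?_
    rw [huIoc] at ht
    exact hasFDerivAt_logIntegrand (hX t ⟨ht.1.le, ht.2⟩).1

/-- An antiderivative is `t (1 + t (A - 1))⁻¹`, equal to `0` at `0` and to `A⁻¹` at `1`. -/
theorem integral_inv_sq {A : Mat m} (hA : LogDomain A) :
    ∫ t in (0 : ℝ)..1, (1 + (t : ℂ) • (A - 1))⁻¹ * (1 + (t : ℂ) • (A - 1))⁻¹ = A⁻¹ := by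
  have hd : ∀ t ∈ Set.uIcc (0 : ℝ) 1, HasDerivAt (fun t : ℝ => (t : ℂ) • (1 + (t : ℂ) • (A - 1))⁻¹)
      ((1 + (t : ℂ) • (A - 1))⁻¹ * (1 + (t : ℂ) • (A - 1))⁻¹) t := by
    intro t ht
    rw [Set.uIcc_of_le zero_le_one] at ht
    have h1 : HasDerivAt (fun t : ℝ => 1 + (t : ℂ) • (A - 1)) (A - 1) t := by
      have := (Complex.ofRealCLM.hasDerivAt (x := t)).smul_const (A - 1)
      simpa using this.const_add 1
    have hu0 := hA t ht
    have hR := Matrix.nonsing_inv_mul _ ((Matrix.isUnit_iff_isUnit_det _).1 hu0)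
    obtain ⟨u, hu⟩ := hu0
    have h2 := hasFDerivAt_ringInverse (𝕜 := ℝ) u
    rw [hu] at h2
    have h3 := h2.comp_hasDerivAt t h1
    have h4 := (Complex.ofRealCLM.hasDerivAt (x := t)).smul h3
    have hinv : ((u⁻¹ : (Mat m)ˣ) : Mat m) = (1 + (t : ℂ) • (A - 1))⁻¹ := by
      rw [← hu]; exact Matrix.coe_units_inv u
    refine (h4.congr_deriv ?_).congr_of_eventuallyEq (Eventually.of_forall fun X => ?_)
    · simp only [Function.comp_apply, neg_apply, ContinuousLinearMap.mulLeftRight_apply, hinv,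
        Complex.ofRealCLM_apply, Complex.ofReal_one, one_smul,
        ← Matrix.nonsing_inv_eq_ringInverse]
      set R := (1 + (t : ℂ) • (A - 1))⁻¹ with hRdef
      have h5 : R + (t : ℂ) • (R * (A - 1)) = 1 := by
        rw [mul_add, mul_one, mul_smul_comm] at hR
        exact hR
      have h6 : R * R = R - (t : ℂ) • (R * (A - 1) * R) := by
        have := congrArg (· * R) h5
        simp only [add_mul, one_mul, smul_mul_assoc] at this
        exact eq_sub_of_add_eq this
      rw [h6]
      module
    · simp only [Matrix.nonsing_inv_eq_ringInverse]
      rfl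
  rw [intervalIntegral.integral_eq_sub_of_hasDerivAt hd]
  · simp
  · refine ContinuousOn.intervalIntegrable ?_
    rw [Set.uIcc_of_le zero_le_one]
    exact (continuousOn_inv_segment hA).mul (continuousOn_inv_segment hA)

/-- In a direction `H` that commutes with `A` the factors of the kernel can be collected, and the
logarithm has the scalar derivative `H A⁻¹`. -/
theorem integral_logKer_apply {A H : Mat m} (hA : LogDomain A) (hH : Commute H A) :
    (∫ t in (0 : ℝ)..1, logKer A t) H = H * A⁻¹ := by
  have h1 := (continuousOn_inv_segment hA)
  have h2 : ContinuousOn (fun t : ℝ => logKer A t) (Set.uIcc 0 1) := by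
    rw [Set.uIcc_of_le zero_le_one]
    unfold logKer
    exact ((ContinuousLinearMap.mulLeftRight ℂ (Mat m)).continuous.comp_continuousOn h1).clm_apply h1
  rw [ContinuousLinearMap.intervalIntegral_apply h2.intervalIntegrable]
  have e : ∀ t : ℝ, logKer A t H =
      H * ((1 + (t : ℂ) • (A - 1))⁻¹ * (1 + (t : ℂ) • (A - 1))⁻¹) := by
    intro t
    have hc : Commute H (1 + (t : ℂ) • (A - 1))⁻¹ :=
      commute_inv ((Commute.one_right H).add_right
        ((hH.sub_right (Commute.one_right H)).smul_right _))
    rw [logKer_apply, ← hc.eq, mul_assoc]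
  simp only [e]
  rw [← integral_inv_sq hA]
  have h3 : IntervalIntegrable
      (fun t : ℝ => (1 + (t : ℂ) • (A - 1))⁻¹ * (1 + (t : ℂ) • (A - 1))⁻¹) volume 0 1 := by
    refine ContinuousOn.intervalIntegrable ?_
    rw [Set.uIcc_of_le zero_le_one]
    exact h1.mul h1
  exact ((ContinuousLinearMap.mul ℝ (Mat m)) H).intervalIntegral_comp_comm h3

/-! ### A uniform bound for the imaginary part of the logarithm -/

/-- The quadratic form of a matrix at a vector, as a function of the matrix. -/
def quadForm (x : EuclideanSpace ℂ (Fin m)) : Mat m →L[ℂ] ℂ :=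
  LinearMap.toContinuousLinearMap
    { toFun := fun X => inner ℂ x (Matrix.toEuclideanCLM (𝕜 := ℂ) X x)
      map_add' := fun X Y => by rw [map_add, add_apply, inner_add_right]
      map_smul' := fun c X => by
        rw [map_smul, smul_apply, inner_smul_right, RingHom.id_apply, smul_eq_mul] }

theorem norm_inner_toEuclideanCLM_le (x : EuclideanSpace ℂ (Fin m)) (X : Mat m) :
    ‖inner ℂ x (Matrix.toEuclideanCLM (𝕜 := ℂ) X x)‖ ≤ ‖X‖ * ‖x‖ ^ 2 := by
  refine (norm_inner_le_norm _ _).trans ?_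
  have := (Matrix.toEuclideanCLM (𝕜 := ℂ) X).le_opNorm x
  rw [Matrix.l2_opNorm_toEuclideanCLM] at this
  nlinarith [norm_nonneg x]

/-- The quadratic form of the imaginary part of the logarithm increases along the segment from an
accretive matrix to a multiple of `i`. -/
theorem im_inner_matLog_le {A : Mat m} (hA : Accretive A) {σ : ℝ} (hσ : σ * σ = 1)
    (x : EuclideanSpace ℂ (Fin m)) :
    σ * (inner ℂ x (Matrix.toEuclideanCLM (𝕜 := ℂ) (matLog A) x)).im ≤
      ‖matLog ((σ * Complex.I) • (1 : Mat m))‖ * ‖x‖ ^ 2 := by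
  set w : ℂ := σ * Complex.I with hw
  have hwre : w.re = 0 := by simp [hw]
  have hσ0 : σ ≠ 0 := by rintro rfl; simp at hσ
  have hw0 : w ≠ 0 := by simp [hw, hσ0]
  set B : ℝ → Mat m := fun τ => ((1 - τ : ℝ) : ℂ) • A + (τ : ℂ) • (w • (1 : Mat m)) with hB
  set ℓ : Mat m →L[ℝ] ℝ := σ • (Complex.imCLM ∘L (quadForm x).restrictScalars ℝ) with hℓ
  have hℓa : ∀ X : Mat m, ℓ X = σ * (inner ℂ x (Matrix.toEuclideanCLM (𝕜 := ℂ) X x)).im :=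
    fun X => rfl
  have hBd : ∀ τ : ℝ, HasDerivAt B (w • (1 : Mat m) - A) τ := by
    intro τ
    have e : B = fun τ : ℝ => A + (τ : ℂ) • (w • (1 : Mat m) - A) := by
      funext τ; simp only [hB]; push_cast; module
    rw [e]
    have := (Complex.ofRealCLM.hasDerivAt (x := τ)).smul_const (w • (1 : Mat m) - A)
    simpa using this.const_add A
  have hdom : ∀ τ ∈ Set.Icc (0 : ℝ) 1, LogDomain (B τ) := fun τ hτ =>
    logDomain_path hA hwre hw0 hτ
  have hd : ∀ τ ∈ Set.Icc (0 : ℝ) 1, HasDerivAt (fun τ => ℓ (matLog (B τ)))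
      (ℓ ((w • (1 : Mat m) - A) * (B τ)⁻¹)) τ := by
    intro τ hτ
    have hc : Commute (w • (1 : Mat m) - A) (B τ) := by
      have h1 : Commute A (B τ) := ((Commute.refl A).smul_right _).add_right
        (((Commute.one_right A).smul_right _).smul_right _)
      exact ((Commute.one_left _).smul_left _).sub_left h1
    have h1 := ((hasFDerivAt_matLog (hdom τ hτ)).restrictScalars ℝ).comp_hasDerivAt τ (hBd τ)
    have h2 := ℓ.hasFDerivAt.comp_hasDerivAt τ h1
    refine h2.congr_deriv ?_
    rw [ContinuousLinearMap.coe_restrictScalars', integral_logKer_apply (hdom τ hτ) hc]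
  have hmono : MonotoneOn (fun τ => ℓ (matLog (B τ))) (Set.Icc 0 1) := by
    refine monotoneOn_of_hasDerivWithinAt_nonneg (convex_Icc 0 1)
      (fun τ hτ => (hd τ hτ).continuousAt.continuousWithinAt)
      (fun τ hτ => (hd τ (interior_subset hτ)).hasDerivWithinAt) fun τ hτ => ?_
    rw [interior_Icc] at hτ
    have hacc : Accretive (B τ) := by
      have := accretive_combination hA hwre (a := 0) (b := 1 - τ) (c := τ) le_rfl
        (by linarith [hτ.2]) (by linarith [hτ.2])
      simpa [hB] using this
    have hinv := Matrix.mul_nonsing_inv _ ((Matrix.isUnit_iff_isUnit_det _).1 hacc.isUnit)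
    -- Since `(1 - τ)(w - A) = w - B τ`, the derivative of `matLog (B τ)` involves only the inverse
    -- of `B τ`.
    have e : (w • (1 : Mat m) - A) * (B τ)⁻¹ = (1 - τ : ℝ)⁻¹ • (w • (B τ)⁻¹ - 1) := by
      rw [eq_inv_smul_iff₀ (by linarith [hτ.2])]
      have e1 : ((1 - τ : ℝ) : ℂ) • (w • (1 : Mat m) - A) = w • 1 - B τ := by
        simp only [hB]; push_cast; module
      rw [← Complex.coe_smul, ← smul_mul_assoc, e1, sub_mul, hinv, smul_mul_assoc, one_mul]
    rw [e, map_smul, hℓa]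
    have h3 := re_inner_inv_nonneg hacc x
    have h4 : (inner ℂ x x).im = 0 := inner_self_im (𝕜 := ℂ) x
    -- The identity contributes a real number, and `w = σ i` with `σ² = 1` turns the imaginary part
    -- into the real part, which is nonnegative for the inverse of an accretive matrix.
    have h5 : σ * (inner ℂ x (Matrix.toEuclideanCLM (𝕜 := ℂ) (w • (B τ)⁻¹ - 1) x)).im =
        (inner ℂ x (Matrix.toEuclideanCLM (𝕜 := ℂ) (B τ)⁻¹ x)).re := by
      simp only [map_sub, map_smul, map_one, sub_apply, smul_apply, one_apply_eq_self,
        inner_sub_right, inner_smul_right, Complex.sub_im, h4, hw, Complex.mul_im, Complex.mul_re,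
        Complex.ofReal_re, Complex.ofReal_im, Complex.I_re, Complex.I_im]
      linear_combination (inner ℂ x (Matrix.toEuclideanCLM (𝕜 := ℂ) (B τ)⁻¹ x)).re * hσ
    rw [h5, smul_eq_mul]
    exact mul_nonneg (inv_nonneg.2 (by linarith [hτ.2])) h3
  have h := hmono (Set.left_mem_Icc.2 zero_le_one) (Set.right_mem_Icc.2 zero_le_one) zero_le_one
  have hB0 : B 0 = A := by simp [hB]
  have hB1 : B 1 = w • 1 := by simp [hB]
  simp only [hB0, hB1, hℓa] at h
  refine h.trans ((le_abs_self _).trans ?_)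
  have hσ1 : |σ| = 1 := by
    rcases mul_self_eq_one_iff.1 hσ with h | h <;> simp [h]
  rw [abs_mul, hσ1, one_mul]
  exact (Complex.abs_im_le_norm _).trans (norm_inner_toEuclideanCLM_le x _)

theorem exists_bound_im_inner_matLog (m : ℕ) : ∃ c : ℝ, 0 ≤ c ∧ ∀ A : Mat m, Accretive A →
    ∀ x : EuclideanSpace ℂ (Fin m),
      |(inner ℂ x (Matrix.toEuclideanCLM (𝕜 := ℂ) (matLog A) x)).im| ≤ c * ‖x‖ ^ 2 := by
  obtain ⟨c₁, h₁⟩ : ∃ c : ℝ, c = ‖matLog ((((1 : ℝ) : ℂ) * Complex.I) • (1 : Mat m))‖ := ⟨_, rfl⟩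
  obtain ⟨c₂, h₂⟩ : ∃ c : ℝ, c = ‖matLog ((((-1 : ℝ) : ℂ) * Complex.I) • (1 : Mat m))‖ := ⟨_, rfl⟩
  have p₁ : 0 ≤ c₁ := h₁ ▸ norm_nonneg _
  have p₂ : 0 ≤ c₂ := h₂ ▸ norm_nonneg _
  refine ⟨c₁ + c₂, add_nonneg p₁ p₂, fun A hA x => ?_⟩
  have e₁ := im_inner_matLog_le hA (σ := 1) (by norm_num) x
  have e₂ := im_inner_matLog_le hA (σ := -1) (by norm_num) x
  rw [← h₁] at e₁
  rw [← h₂] at e₂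
  have q₁ := mul_nonneg p₁ (sq_nonneg ‖x‖)
  have q₂ := mul_nonneg p₂ (sq_nonneg ‖x‖)
  rw [abs_le, add_mul]
  constructor <;> linarith

/-- Polarization of the form of `N - Nᴴ`, which is at most `2 c ‖x‖²`. Each of the four vectors `eᵢ
+ u eⱼ` with `|u| = 1` has squared norm at most `4`, so each term is at most `8 c`; four terms are
divided by `4`. -/
theorem norm_sub_conj_le_of_im_inner {N : Mat m} {c : ℝ} (hc0 : 0 ≤ c)
    (him : ∀ x : EuclideanSpace ℂ (Fin m),
      |(inner ℂ x (Matrix.toEuclideanCLM (𝕜 := ℂ) N x)).im| ≤ c * ‖x‖ ^ 2) (i j : Fin m) :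
    ‖N i j - conj (N j i)‖ ≤ 8 * c := by
  set T : EuclideanSpace ℂ (Fin m) →ₗ[ℂ] EuclideanSpace ℂ (Fin m) :=
    (Matrix.toEuclideanCLM (𝕜 := ℂ) (N - Nᴴ)).toLinearMap with hT
  have hTa : ∀ x, T x = Matrix.toEuclideanCLM (𝕜 := ℂ) N x -
      Matrix.toEuclideanCLM (𝕜 := ℂ) Nᴴ x := fun x => by
    have : T x = Matrix.toEuclideanCLM (𝕜 := ℂ) (N - Nᴴ) x := rfl
    rw [this, map_sub, sub_apply]
  have hq : ∀ x, ‖inner ℂ (T x) x‖ ≤ 2 * c * ‖x‖ ^ 2 := by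
    intro x
    rw [hTa, inner_sub_left, inner_toEuclideanCLM_left Nᴴ, Matrix.conjTranspose_conjTranspose,
      ← inner_conj_symm (Matrix.toEuclideanCLM (𝕜 := ℂ) N x) x]
    have h : ∀ z : ℂ, conj z - z = ((-2 * z.im : ℝ) : ℂ) * Complex.I := by
      intro z
      apply Complex.ext <;> simp
      ring
    rw [h, norm_mul, Complex.norm_I, mul_one, Complex.norm_real, Real.norm_eq_abs, abs_mul,
      abs_neg, abs_two]
    linarith [him x]
  have hpol := inner_map_polarization T (EuclideanSpace.single i 1) (EuclideanSpace.single j 1)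
  have hnorm : ∀ u : ℂ, ‖u‖ = 1 →
      ‖(EuclideanSpace.single i (1 : ℂ) : EuclideanSpace ℂ (Fin m)) +
        u • EuclideanSpace.single j 1‖ ^ 2 ≤ 4 := by
    intro u hu
    have h := norm_add_le (EuclideanSpace.single i (1 : ℂ) : EuclideanSpace ℂ (Fin m))
      (u • EuclideanSpace.single j 1)
    rw [norm_smul, hu] at h
    simp only [PiLp.norm_single, norm_one, mul_one] at h
    nlinarith [norm_nonneg ((EuclideanSpace.single i (1 : ℂ) : EuclideanSpace ℂ (Fin m)) +
        u • EuclideanSpace.single j 1)]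
  have hq' : ∀ u : ℂ, ‖u‖ = 1 →
      ‖inner ℂ (T (EuclideanSpace.single i (1 : ℂ) + u • EuclideanSpace.single j 1))
        ((EuclideanSpace.single i (1 : ℂ) : EuclideanSpace ℂ (Fin m)) +
          u • EuclideanSpace.single j 1)‖ ≤ 8 * c := by
    intro u hu
    refine (hq _).trans ?_
    nlinarith [hnorm u hu]
  have b1 := hq' 1 (by simp)
  have b2 := hq' (-1) (by simp)
  have b3 := hq' Complex.I (by simp)
  have b4 := hq' (-Complex.I) (by simp)
  simp only [one_smul, neg_smul, ← sub_eq_add_neg] at b1 b2 b3 b4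
  have hent : inner ℂ (T (EuclideanSpace.single j 1)) (EuclideanSpace.single i 1) =
      conj (N i j - conj (N j i)) := by
    have he : ∀ X : Mat m, inner ℂ (Matrix.toEuclideanCLM (𝕜 := ℂ) X (EuclideanSpace.single j 1))
        (EuclideanSpace.single i (1 : ℂ)) = conj (X i j) := by
      intro X
      rw [EuclideanSpace.inner_single_right, one_mul, Matrix.ofLp_toEuclideanCLM]
      simp
    rw [hTa, inner_sub_left, he, he, map_sub, Matrix.conjTranspose_apply]
    rfl
  rw [hent] at hpol
  have hfin : ‖conj (N i j - conj (N j i))‖ ≤ 8 * c := by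
    rw [hpol, norm_div, Complex.norm_ofNat, div_le_iff₀ (by norm_num)]
    refine (norm_sub_le _ _).trans ?_
    rw [norm_mul, Complex.norm_I, one_mul]
    refine (add_le_add ((norm_add_le _ _).trans (add_le_add (norm_sub_le _ _) le_rfl)) le_rfl).trans
      ?_
    rw [norm_mul, Complex.norm_I, one_mul]
    linarith
  rwa [RCLike.norm_conj] at hfin

/-- The imaginary part of the logarithm of an accretive matrix is bounded by a constant. -/
theorem exists_bound_matLog_sub_conj (m : ℕ) : ∃ C : ℝ, ∀ A : Mat m, Accretive A →
    ∀ i j, ‖matLog A i j - conj (matLog A j i)‖ ≤ C := by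
  obtain ⟨c, hc, h⟩ := exists_bound_im_inner_matLog m
  exact ⟨8 * c, fun A hA i j => norm_sub_conj_le_of_im_inner hc (h A hA) i j⟩

/-! ### Taylor coefficients of the logarithm of `M11` -/

theorem accretive_M11 (hα : ∀ k, ‖α k‖ < 1) (k : ℤ) {z : ℂ} (hz : ‖z‖ < 1) :
    Accretive (M11 α hα k z) := fun _ hx => re_inner_M11_pos hα k hz hx

theorem differentiableOn_log_M11 (hα : ∀ k, ‖α k‖ < 1) (k : ℤ) :
    DifferentiableOn ℂ (fun z => matLog (M11 α hα k z)) (Metric.ball 0 1) := by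
  intro z hz
  have h1 := (differentiableOn_M11 hα k).differentiableAt (Metric.isOpen_ball.mem_nhds hz)
  rw [mem_ball_zero_iff] at hz
  exact ((hasFDerivAt_matLog (accretive_M11 hα k hz).logDomain).differentiableAt.comp z
    h1).differentiableWithinAt

theorem hasSum_log_M11 (hα : ∀ k, ‖α k‖ < 1) (k : ℤ) {z : ℂ} (hz : z ∈ Metric.ball (0 : ℂ) 1) :
    HasSum (fun n : ℕ => z ^ n • L α hα k n) (matLog (M11 α hα k z)) := by
  have h := Complex.hasSum_taylorSeries_on_ball (differentiableOn_log_M11 hα k) hz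
  have e : ∀ n : ℕ, (n.factorial : ℂ)⁻¹ • z ^ n •
      iteratedDeriv n (fun z => matLog (M11 α hα k z)) 0 = z ^ n • L α hα k n :=
    fun n => smul_comm _ _ _
  simpa only [sub_zero, e] using h

theorem M11_zero (hα : ∀ k, ‖α k‖ < 1) (k : ℤ) : M11 α hα k 0 = 1 := by
  obtain ⟨R, -, hR⟩ := exists_M11_expansion hα k
  simpa using hR 0 (by simp)

theorem matLog_one : matLog (1 : Mat m) = 0 := by simp [matLog]

theorem L_zero (hα : ∀ k, ‖α k‖ < 1) (k : ℤ) : L α hα k 0 = 0 := by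
  simp [L, M11_zero, matLog_one]

/-- Divide by `z` and let `z → 0` off the origin to get `X = 0`, then divide by `z²`. -/
theorem eq_zero_of_isBigO {X Y : Mat m}
    (h : (fun z : ℂ => z • X + z ^ 2 • Y) =O[𝓝 0] fun z : ℂ => z ^ 3) : X = 0 ∧ Y = 0 := by
  have key : ∀ (f : ℂ → Mat m) (n : ℕ), Continuous f →
      (fun z : ℂ => z ^ n • f z) =O[𝓝 0] (fun z : ℂ => z ^ (n + 1)) → f 0 = 0 := by
    intro f n hf h
    have h1 : f =O[𝓝[≠] 0] (fun z : ℂ => z) := by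
      obtain ⟨C, hC⟩ := h.bound
      refine Asymptotics.IsBigO.of_bound C ?_
      filter_upwards [hC.filter_mono nhdsWithin_le_nhds, self_mem_nhdsWithin] with z hz hz0
      have hp : 0 < ‖z‖ ^ n := pow_pos (norm_pos_iff.2 hz0) n
      rw [norm_smul, norm_pow, norm_pow, pow_succ] at hz
      refine le_of_mul_le_mul_left ?_ hp
      linarith
    have h2 : Tendsto f (𝓝[≠] 0) (𝓝 0) :=
      h1.trans_tendsto (tendsto_id.mono_left nhdsWithin_le_nhds)
    exact tendsto_nhds_unique ((hf.tendsto 0).mono_left nhdsWithin_le_nhds) h2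
  have hX : X = 0 := by
    have := key (fun z => X + z • Y) 1 (by fun_prop) ((h.trans ?_).congr_left fun z => ?_)
    · simpa using this
    · refine Asymptotics.IsBigO.of_bound 1 ?_
      filter_upwards [Metric.ball_mem_nhds (0 : ℂ) one_pos] with z hz
      rw [mem_ball_zero_iff] at hz
      rw [norm_pow, norm_pow, one_mul]
      exact pow_le_pow_of_le_one (norm_nonneg z) hz.le (by norm_num)
    · module
  refine ⟨hX, key (fun _ => Y) 2 continuous_const (h.congr_left fun z => ?_)⟩
  rw [hX, smul_zero, zero_add]

/-- The first two Taylor coefficients of `ln M₁,₁`. -/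
theorem L_one_L_two (hα : ∀ k, ‖α k‖ < 1) (k : ℤ) :
    L α hα k 1 = (2 : ℂ) • compress k (opUinv α hα) ∧
    L α hα k 2 = (2 : ℂ) • (compress k (opUinv α hα * opUinv α hα) -
      compress k (opUinv α hα) * compress k (opUinv α hα)) := by
  set F : ℂ → Mat m := fun z => matLog (M11 α hα k z) with hF
  set A₁ := compress k (opUinv α hα)
  set A₂ := compress k (opUinv α hα * opUinv α hα)
  obtain ⟨R, hRc, hR⟩ := exists_M11_expansion hα k
  have hball : ∀ᶠ z in 𝓝 (0 : ℂ), z ∈ Metric.ball (0 : ℂ) 1 := Metric.ball_mem_nhds _ one_pos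
  have hM : (fun z => M11 α hα k z - (1 + (2 * z) • A₁ + (2 * z ^ 2) • A₂)) =O[𝓝 0]
      fun z : ℂ => z ^ 3 := by
    have h1 : (fun z : ℂ => z ^ 3 • R z) =O[𝓝 0] fun z : ℂ => z ^ 3 • (1 : ℂ) :=
      (Asymptotics.isBigO_refl _ _).smul (hRc.norm.isBoundedUnder_le.isBigO_one ℂ)
    simp only [smul_eq_mul, mul_one] at h1
    refine h1.congr' ?_ EventuallyEq.rfl
    filter_upwards [hball] with z hz
    rw [hR z hz]
    abel
  let p : FormalMultilinearSeries ℂ ℂ (Mat m) :=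
    fun n => ContinuousMultilinearMap.mkPiRing ℂ (Fin n) (L α hα k n)
  have hp : ∀ (n : ℕ) (z : ℂ), (p n fun _ => z) = z ^ n • L α hα k n := fun n z => by
    simp [p]
  have hFs : HasFPowerSeriesAt F p 0 := by
    refine hasFPowerSeriesAt_iff.2 ?_
    filter_upwards [hball] with z hz
    rw [zero_add]
    have hc : ∀ n, p.coeff n = L α hα k n := fun n => by
      have := hp n 1
      rwa [one_pow, one_smul] at this
    simpa only [hc] using hasSum_log_M11 hα k hz
  have hF3 : (fun z => F z - (z • L α hα k 1 + z ^ 2 • L α hα k 2)) =O[𝓝 0] fun z : ℂ => z ^ 3 := by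
    have h := hFs.isBigO_sub_partialSum_pow 3
    refine (h.trans (Asymptotics.IsBigO.of_bound 1 (by simp))).congr_left fun z => ?_
    simp [FormalMultilinearSeries.partialSum, Finset.sum_range_succ, L_zero, hp]
  have hz1 : ∀ X : Mat m, (fun z : ℂ => z • X) =O[𝓝 0] fun z : ℂ => z := fun X =>
    Asymptotics.IsBigO.of_bound ‖X‖ (Eventually.of_forall fun z => by rw [norm_smul, mul_comm])
  have hz2 : ∀ X : Mat m, (fun z : ℂ => z ^ 2 • X) =O[𝓝 0] fun z : ℂ => z ^ 2 := fun X =>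
    Asymptotics.IsBigO.of_bound ‖X‖ (Eventually.of_forall fun z => by rw [norm_smul, mul_comm])
  have hpow : ∀ {i j : ℕ}, i ≤ j → (fun z : ℂ => z ^ j) =O[𝓝 0] fun z : ℂ => z ^ i := by
    intro i j hij
    refine Asymptotics.IsBigO.of_bound 1 ?_
    filter_upwards [hball] with z hz
    rw [mem_ball_zero_iff] at hz
    rw [norm_pow, norm_pow, one_mul]
    exact pow_le_pow_of_le_one (norm_nonneg z) hz.le hij
  have hD : (fun z => F z - z • L α hα k 1) =O[𝓝 0] fun z : ℂ => z ^ 2 := by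
    refine ((hF3.trans (hpow (by norm_num))).add (hz2 (L α hα k 2))).congr_left fun z => ?_
    abel
  have hF1 : F =O[𝓝 0] fun z : ℂ => z := by
    have h := hD.trans (hpow (i := 1) (by norm_num))
    simp only [pow_one] at h
    exact (h.add (hz1 (L α hα k 1))).congr_left fun z => by abel
  have hF2 : (fun z => F z * F z - z ^ 2 • (L α hα k 1 * L α hα k 1)) =O[𝓝 0]
      fun z : ℂ => z ^ 3 := by
    have h1 := (hF1.mul hD).congr_right (g₂ := fun z : ℂ => z ^ 3) fun z => by ring
    have h2 := (hD.mul (hz1 (L α hα k 1))).congr_right (g₂ := fun z : ℂ => z ^ 3)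
      fun z => by ring
    refine (h1.add h2).congr_left fun z => ?_
    simp only [mul_sub, sub_mul, smul_mul_assoc, mul_smul_comm]
    module
  have hFt : Tendsto F (𝓝 0) (𝓝 0) := hF1.trans_tendsto tendsto_id
  -- Comparing through `exp (ln M) = M` avoids expanding the integral that defines the logarithm.
  have hE : (fun z => M11 α hα k z - (1 + F z + (2 : ℂ)⁻¹ • (F z * F z))) =O[𝓝 0]
      fun z : ℂ => z ^ 3 := by
    have h := (NormedSpace.exp_hasFPowerSeriesAt_zero (𝕂 := ℂ)
      (𝔸 := Mat m)).isBigO_sub_partialSum_pow 3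
    have h2 := (h.comp_tendsto hFt).trans (hF1.norm_left.pow 3)
    refine h2.congr' ?_ EventuallyEq.rfl
    filter_upwards [hball] with z hz
    rw [mem_ball_zero_iff] at hz
    have he : NormedSpace.exp (F z) = M11 α hα k z :=
      exp_matLog _ (accretive_M11 hα k hz).logDomain
    simp [FormalMultilinearSeries.partialSum, Finset.sum_range_succ,
      NormedSpace.expSeries_apply_eq, he, sq]
  have hall : (fun z : ℂ => z • (L α hα k 1 - (2 : ℂ) • A₁) +
      z ^ 2 • (L α hα k 2 + (2 : ℂ)⁻¹ • (L α hα k 1 * L α hα k 1) - (2 : ℂ) • A₂)) =O[𝓝 0]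
      fun z : ℂ => z ^ 3 := by
    have hF2' : (fun z => (2 : ℂ)⁻¹ • (F z * F z - z ^ 2 • (L α hα k 1 * L α hα k 1))) =O[𝓝 0]
        fun z : ℂ => z ^ 3 := hF2.const_smul_left (2 : ℂ)⁻¹
    refine (((hM.sub hE).sub hF3).sub hF2').congr_left fun z => ?_
    module
  obtain ⟨h1, h2⟩ := eq_zero_of_isBigO hall
  have h1' := sub_eq_zero.1 h1
  refine ⟨h1', ?_⟩
  -- The second-order comparison reads `L 2 + (L 1)² / 2 = 2 A₂`; inserting `L 1 = 2 A₁` leaves `L 2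
  -- = 2 (A₂ - A₁²)`.
  rw [h1', sub_eq_zero] at h2
  rw [smul_sub, ← h2, smul_mul_smul_comm]
  module

/-! ### Boundary values of the logarithm -/

/-- A matrix entry, as a continuous linear map. -/
def entryCLM (i j : Fin m) : Mat m →L[ℂ] ℂ :=
  LinearMap.toContinuousLinearMap (Matrix.entryLinearMap ℂ ℂ i j)

theorem entryCLM_apply (i j : Fin m) (A : Mat m) : entryCLM i j A = A i j := rfl

/-- The `H²` criterion applied to the entries `(i, j)` and `(j, i)` of `ln M11`: the first minus the
conjugate of the second is `2i` times an entry of the bounded imaginary part. -/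
theorem summable_sq_L (hα : ∀ k, ‖α k‖ < 1) (k : ℤ) (i j : Fin m) :
    Summable fun n => ‖L α hα k n i j‖ ^ 2 := by
  obtain ⟨C, hC⟩ := exists_bound_matLog_sub_conj m
  have hd : ∀ i j, DifferentiableOn ℂ (fun z => matLog (M11 α hα k z) i j) (Metric.ball 0 1) :=
    fun i j => (entryCLM i j).differentiable.comp_differentiableOn (differentiableOn_log_M11 hα k)
  refine summable_sq_of_norm_sub_conj_le (hd i j) (hd j i) (fun z hz => ?_) ?_ (C := C)
    fun z hz => ?_
  · have h := (hasSum_log_M11 hα k hz).mapL (entryCLM i j)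
    simp only [map_smul, entryCLM_apply, smul_eq_mul] at h
    simpa only [mul_comm] using h
  · simp [M11_zero, matLog_one]
  · exact hC _ (accretive_M11 hα k (by simpa using hz)) i j

theorem imPart_apply (A : Mat m) (i j : Fin m) :
    imPart A i j = (2 * Complex.I)⁻¹ * (A i j - conj (A j i)) := by
  simp [imPart, Matrix.conjTranspose_apply]

theorem continuous_imPart : Continuous (imPart : Mat m → Mat m) := by
  unfold imPart
  fun_prop

/-- Existence of an integrable function on the circle with the Taylor coefficients of
`ln M₁,₁` as its Fourier coefficients, which is the radial limit of `ln M₁,₁`. -/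
theorem exists_boundary_log_M11 (hα : ∀ k, ‖α k‖ < 1) (k : ℤ) :
    ∃ G : ℝ → Mat m, (∀ i j, IntervalIntegrable (fun θ => G θ i j) volume 0 (2 * Real.pi)) ∧
      (∀ᵐ θ : ℝ, Tendsto (fun r : ℝ => matLog (M11 α hα k (r * circleMap 0 1 θ)))
        (𝓝[<] 1) (𝓝 (G θ))) ∧
      ∀ i j, ∀ n : ℤ, ∫ θ in 0..2 * Real.pi, Complex.exp (-(n * θ * Complex.I)) * G θ i j =
        2 * Real.pi * extendZero (fun l => L α hα k l i j) n := by
  have h : ∀ i j : Fin m, _ := fun i j =>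
    exists_radial_limit (a := fun n => L α hα k n i j) (by simp [L_zero]) (summable_sq_L hα k i j)
  choose G hint hlim hcoef using h
  refine ⟨fun θ => Matrix.of fun i j => G i j θ, fun i j => hint i j _ _, ?_, hcoef⟩
  have hlim' : ∀ᵐ θ : ℝ, ∀ i j, _ := ae_all_iff.2 fun i => ae_all_iff.2 fun j => hlim i j
  filter_upwards [hlim'] with θ hθ
  refine tendsto_pi_nhds.2 fun i => tendsto_pi_nhds.2 fun j => ?_
  refine (hθ i j).congr' ?_
  have hpos : ∀ᶠ r : ℝ in 𝓝[<] 1, 0 ≤ r :=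
    (eventually_ge_nhds (by norm_num)).filter_mono nhdsWithin_le_nhds
  filter_upwards [hpos, self_mem_nhdsWithin] with r hr0 hr1
  have hr1 : r < 1 := hr1
  have hz : (r : ℂ) * circleMap 0 1 θ ∈ Metric.ball (0 : ℂ) 1 := by
    simp [abs_of_nonneg hr0, hr1]
  have hs := (hasSum_log_M11 hα k hz).mapL (entryCLM i j)
  simp only [map_smul, entryCLM_apply, smul_eq_mul] at hs
  rw [← hs.tsum_eq]
  refine tsum_congr fun n => ?_
  have : circleMap 0 1 θ ^ n = Complex.exp (n * θ * Complex.I) := by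
    simp [circleMap, ← Complex.exp_nat_mul, mul_assoc]
  rw [mul_pow, this]
  ring

theorem conj_circleMap_pow (θ : ℝ) (n : ℕ) :
    conj (circleMap 0 1 θ) ^ n = Complex.exp (-(n * θ * Complex.I)) := by
  simp [circleMap, ← Complex.exp_conj, ← Complex.exp_nat_mul, mul_assoc]

theorem intervalIntegrable_of_entries {f : ℝ → Mat m} {a b : ℝ}
    (h : ∀ i j, IntervalIntegrable (fun θ => f θ i j) volume a b) :
    IntervalIntegrable f volume a b := by
  have e : f = fun θ => ∑ i, ∑ j, f θ i j • Matrix.single i j (1 : ℂ) := by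
    funext θ
    conv_lhs => rw [Matrix.matrix_eq_sum_single (f θ)]
    simp
  rw [e]
  have hs : ∀ i j, IntervalIntegrable (fun θ => f θ i j • Matrix.single i j (1 : ℂ)) volume a b :=
    fun i j => ⟨(h i j).1.smul_const _, (h i j).2.smul_const _⟩
  have := IntervalIntegrable.sum Finset.univ fun i _ =>
    IntervalIntegrable.sum Finset.univ fun j _ => hs i j
  have e2 : (fun θ => ∑ i, ∑ j, f θ i j • Matrix.single i j (1 : ℂ)) =
      ∑ i, ∑ j, fun θ => f θ i j • Matrix.single i j (1 : ℂ) := by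
    funext θ
    simp only [Finset.sum_apply]
  rw [e2]
  exact this

end CMV

end

/-! ### The trace formulas -/

open CMV in
theorem theorem2p4 (m : ℕ) (α : ℤ → Matrix (Fin m) (Fin m) ℂ) (hα : ∀ k, ‖α k‖ < 1) (k₀ : ℤ) :
    -- `ln M₁,₁(·, k₀)` is analytic near `0`, with the norm convergent expansion `∑_{j ≥ 1} Lⱼ zʲ`
    (AnalyticAt ℂ (fun z : ℂ => matLog (M11 α hα k₀ z)) 0 ∧
      ∀ᶠ z : ℂ in 𝓝 0,
        HasSum (fun j : ℕ => z ^ (j + 1) • L α hα k₀ (j + 1)) (matLog (M11 α hα k₀ z))) ∧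
    -- the radial limits that define `Ξ₁,₁(·, k₀)` exist a.e. on the circle
    (∀ᵐ θ : ℝ, Tendsto (fun r : ℝ => imPart (matLog (M11 α hα k₀ (r * circleMap 0 1 θ))))
      (𝓝[<] 1) (𝓝 (Xi11 α hα k₀ (circleMap 0 1 θ)))) ∧
    CircleIntegrable (Xi11 α hα k₀) 0 1 ∧
    -- the trace formulas
    (∀ j : ℕ, 1 ≤ j → L α hα k₀ j =
      (2 * Complex.I) • Real.circleAverage (fun ζ => (conj ζ) ^ j • Xi11 α hα k₀ ζ) 0 1) ∧
    -- the case `j = 1`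
    (L α hα k₀ 1 = (-2 : ℂ) • (if Odd k₀ then α k₀ * (α (k₀ + 1))ᴴ else (α (k₀ + 1))ᴴ * α k₀) ∧
      L α hα k₀ 1 = (2 * Complex.I) • Real.circleAverage (fun ζ => conj ζ • Xi11 α hα k₀ ζ) 0 1) ∧
    -- the case `j = 2`
    (L α hα k₀ 2 = (-2 : ℂ) •
        (if Odd k₀ then
          α k₀ * rho α (k₀ + 1) * (α (k₀ + 2))ᴴ * rhoT α (k₀ + 1) +
            rhoT α k₀ * α (k₀ - 1) * rho α k₀ * (α (k₀ + 1))ᴴ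
        else
          rho α (k₀ + 1) * (α (k₀ + 2))ᴴ * rhoT α (k₀ + 1) * α k₀ +
            (α (k₀ + 1))ᴴ * rhoT α k₀ * α (k₀ - 1) * rho α k₀) ∧
      L α hα k₀ 2 =
        (2 * Complex.I) • Real.circleAverage (fun ζ => (conj ζ) ^ 2 • Xi11 α hα k₀ ζ) 0 1) := by
  obtain ⟨G, hint, hlim, hcoef⟩ := exists_boundary_log_M11 hα k₀
  have hlimIm : ∀ᵐ θ : ℝ, Tendsto (fun r : ℝ =>
      imPart (matLog (M11 α hα k₀ (r * circleMap 0 1 θ)))) (𝓝[<] 1) (𝓝 (imPart (G θ))) := by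
    filter_upwards [hlim] with θ hθ
    exact (continuous_imPart.tendsto _).comp hθ
  have hXi : ∀ᵐ θ : ℝ, Xi11 α hα k₀ (circleMap 0 1 θ) = imPart (G θ) := by
    filter_upwards [hlimIm] with θ hθ
    exact hθ.limUnder_eq
  have hconj : ∀ i j, IntervalIntegrable (fun θ => conj (G θ i j)) volume 0 (2 * Real.pi) :=
    fun i j => ⟨Complex.conjCLE.toContinuousLinearMap.integrable_comp (hint i j).1,
      Complex.conjCLE.toContinuousLinearMap.integrable_comp (hint i j).2⟩
  have hintIm : IntervalIntegrable (fun θ => imPart (G θ)) volume 0 (2 * Real.pi) := by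
    refine intervalIntegrable_of_entries fun i j => ?_
    simp only [imPart_apply]
    exact ((hint i j).sub (hconj j i)).const_mul _
  have htrace : ∀ j : ℕ, 1 ≤ j → L α hα k₀ j =
      (2 * Complex.I) • Real.circleAverage (fun ζ => (conj ζ) ^ j • Xi11 α hα k₀ ζ) 0 1 := by
    intro n hn
    have hexp : Continuous fun θ : ℝ => Complex.exp (-(n * θ * Complex.I)) := by fun_prop
    have e1 : Real.circleAverage (fun ζ => (conj ζ) ^ n • Xi11 α hα k₀ ζ) 0 1 =
        (2 * Real.pi)⁻¹ • ∫ θ in 0..2 * Real.pi,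
          Complex.exp (-(n * θ * Complex.I)) • imPart (G θ) := by
      rw [Real.circleAverage_def]
      congr 1
      refine intervalIntegral.integral_congr_ae ?_
      filter_upwards [hXi] with θ hθ _
      rw [hθ, conj_circleMap_pow]
    rw [e1]
    ext a b
    have hi : IntervalIntegrable (fun θ : ℝ => Complex.exp (-(n * θ * Complex.I)) • imPart (G θ))
        volume 0 (2 * Real.pi) := hintIm.continuousOn_smul hexp.continuousOn
    have e2 := (entryCLM a b).intervalIntegral_comp_comm hi
    simp only [entryCLM_apply] at e2
    -- The conjugated entry at frequency `n` is the conjugate of the entry `(b, a)` of `G` at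
    -- frequency `-n`, and that Fourier coefficient vanishes because `n ≥ 1`.
    have e3 : ∀ θ : ℝ, (Complex.exp (-(n * θ * Complex.I)) • imPart (G θ)) a b =
        (2 * Complex.I)⁻¹ * (Complex.exp (-(n * θ * Complex.I)) * G θ a b -
          conj (Complex.exp (-(((-n : ℤ) : ℂ) * θ * Complex.I)) * G θ b a)) := by
      intro θ
      rw [Matrix.smul_apply, imPart_apply, smul_eq_mul, map_mul, ← Complex.exp_conj]
      simp
      ring
    simp only [e3] at e2
    have c1 := hcoef a b n
    have c2 := hcoef b a (-n)
    rw [Int.cast_natCast] at c1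
    rw [extendZero_natCast] at c1
    have hz : extendZero (fun l => L α hα k₀ l b a) (-n) = 0 := by
      rw [extendZero, if_neg (by omega)]
    rw [hz, mul_zero] at c2
    have hexp' : Continuous fun θ : ℝ => Complex.exp (-(((-n : ℤ) : ℂ) * θ * Complex.I)) := by
      fun_prop
    have i1 : IntervalIntegrable (fun θ : ℝ => Complex.exp (-(n * θ * Complex.I)) * G θ a b)
        volume 0 (2 * Real.pi) := (hint a b).continuousOn_mul hexp.continuousOn
    have i2 : IntervalIntegrable
        (fun θ : ℝ => Complex.exp (-(((-n : ℤ) : ℂ) * θ * Complex.I)) * G θ b a)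
        volume 0 (2 * Real.pi) := (hint b a).continuousOn_mul hexp'.continuousOn
    have i3 : IntervalIntegrable
        (fun θ : ℝ => conj (Complex.exp (-(((-n : ℤ) : ℂ) * θ * Complex.I)) * G θ b a))
        volume 0 (2 * Real.pi) :=
      ⟨Complex.conjCLE.toContinuousLinearMap.integrable_comp i2.1,
        Complex.conjCLE.toContinuousLinearMap.integrable_comp i2.2⟩
    rw [intervalIntegral.integral_const_mul, intervalIntegral.integral_sub i1 i3,
      intervalIntegral.intervalIntegral_conj, c1, c2, map_zero, sub_zero] at e2
    rw [Matrix.smul_apply, Matrix.smul_apply, ← e2, Complex.real_smul, smul_eq_mul]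
    have hpi : (Real.pi : ℂ) ≠ 0 := by simp [Real.pi_ne_zero]
    have hI := Complex.I_ne_zero
    push_cast
    field_simp
  refine ⟨⟨?_, ?_⟩, ?_, ?_, htrace, ⟨?_, ?_⟩, ?_, htrace 2 (by norm_num)⟩
  · exact (differentiableOn_log_M11 hα k₀).analyticAt (Metric.ball_mem_nhds _ one_pos)
  · filter_upwards [Metric.ball_mem_nhds (0 : ℂ) one_pos] with z hz
    -- The series may start at index `1` because `L 0 = ln 1 = 0`.
    have h := (hasSum_nat_add_iff' 1).2 (hasSum_log_M11 hα k₀ hz)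
    simpa [L_zero] using h
  · filter_upwards [hlimIm, hXi] with θ h1 h2
    rwa [h2]
  · exact hintIm.congr_ae (ae_restrict_of_ae (hXi.mono fun θ h => h.symm))
  · rw [(L_one_L_two hα k₀).1]
    split_ifs with hk
    · rw [compress_opUinv_odd hα hk]; module
    · rw [compress_opUinv_even hα (Int.not_odd_iff_even.1 hk)]; module
  · simpa using htrace 1 le_rfl
  · rw [(L_one_L_two hα k₀).2]
    split_ifs with hk
    · rw [compress_opUinv_sq_odd hα hk]; module
    · rw [compress_opUinv_sq_even hα (Int.not_odd_iff_even.1 hk)]; module
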